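/- **Setting.** Let $H$ be a complex Hilbert space and let $A:D(A)\subset H\to H$ be a densely defined operator that is self-adjoint or skew-adjoint, has compact resolvent and generates a strongly continuous semigroup on $H$. Suppose that $H=\bigoplus_{i=1}^m H_i$, where $H_i$ has an orthonormal basis $(\varphi_{i,n})_{n\ge1}$ of eigenvectors of $A$, $A\varphi_{i,n}=\lambda_{i,n}\varphi_{i,n}$, with $\lambda_{i,n}\neq\lambda_{i,k}$ for $n\ne k$, and that the $\varphi_{i,n}$ together form an orthonormal basis of $H$. Suppose that there are $\alpha>1$ and constants $c,C>0$ such that for all $i$ and all $n,k\ge1$ $$c\,n^{\alpha-1}\le|\lambda_{i,n+1}-\lambda_{i,n}|\le C\,n^{\alpha-1},\qquad c\,k^{\alpha-1}|k-n|\le|\lambda_{i,k}-\lambda_{i,n}|.$$ For $s\ge0$ let $D(A^s)=\{f\in H:\sum_{i,n}(1+|\lambda_{i,n}|^2)^s|\langle f,\varphi_{i,n}\rangle|^2<\infty\}$ with the corresponding norm. Duals are taken with pivot space $H$, so that $D(A)\subset D(A^r)\subset H\subset D(A^r)'\subset D(A)'$ for $0\le r\le1$, and $A$ is extended to $A:H\to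 D(A)'$ by $\langle Ax,v\rangle=\langle x,A^*v\rangle$, $v\in D(A)$. Let $U$ be a complex normed space with a basis $e_1,\dots,e_m$, and let $B\in\mathcal L(U;D(A)')$ be such that the $i$-th control acts on $H_i$ only, i.e. $\langle Be_i,\varphi_{j,n}\rangle=0$ for $j\neq i$, and such that $b_{i,n}:=\langle Be_i,\varphi_{i,n}\rangle$ satisfies $c\le|b_{i,n}|\le C$ for all $i,n$. Call $\mu>0$ *non-resonant* if $\mu\ne\lambda_{i,k}-\lambda_{i,n}$ for all $i,k,n$. For such $\mu$ put $$\tau^{(\mu)}_{i;n,j}=\frac{\mu^2}{\lambda_{i,j}-\lambda_{i,n}-\mu}\prod_{k\ne n}\Big(1+\frac{\mu}{\lambda_{i,n}-\lambda_{i,k}}\Big)\prod_{k\neq j}\Big(1-\frac{\mu}{\lambda_{i,j}-\lambda_{i,k}}\Big),\qquad k^{(\mu)}_{i,n}=\frac1{b_{i,n}}\sum_{j\ge1}\tau^{(\mu)}_{i;n,j}.$$ Denote by $K_\mu$ a linear map $K:\bigcup_{s>1/(2\alpha)}D(A^s)\to U$ which belongs to $\mathcal L(D(A^s);U)$ for every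 $s>\frac1{2\alpha}$ and satisfies $K\varphi_{i,n}=k^{(\mu)}_{i,n}e_i$ for all $i,n$; there is at most one. **Theorem.** 1. For every non-resonant $\mu>0$, the products and series above converge unconditionally, $K_\mu$ exists, and there is a bounded operator $T\in\mathcal L(H)$ with bounded inverse, such that $$T\varphi_{i,n}=k^{(\mu)}_{i,n}\sum_{j\ge1}\frac{b_{i,j}}{\lambda_{i,j}-\lambda_{i,n}-\mu}\,\varphi_{i,j}\quad\text{for all } i,n,$$ $$TAf+BK_\mu f=(A-\mu I)Tf\ \text{ in } D(A)'\ \text{ for all } f\in D(A),\qquad TB=B\ \text{ in } D(A)'.$$ Here $TB=B$ means that for some $r\in[0,1]$ the range of $B$ lies in $D(A^r)'$, $T$ extends to a bounded operator of $D(A^r)'$, and this (unique) extension maps $Bu$ to $Bu$ for every $u\in U$. 2. For every $\lambda>0$ there is a non-resonant $\mu>0$ such that, with $K=K_\mu$ (which exists), the operator $A+BK$ on $H$, with domain the set of $f$ in the domain of $K$ for which $Af+BKf\in D(A)'$ belongs to $H$, generates a strongly continuous semigroup $(e^{(A+BK)t})_{t\ge0}$ on $H$, and for some $C>0$ $$\|e^{(A+BK)t}y_0\|_H\le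 Ce^{-\lambda t}\|y_0\|_H\qquad\text{for all } y_0\in H,\ t\ge0.$$ -/

import Mathlib

namespace Backstepping

open Filter Topology
open scoped NNReal

section Semigroups

variable {H : Type*} [NormedAddCommGroup H] [NormedSpace ℂ H]

/-- Strongly continuous semigroups of bounded operators, indexed by the times `t ≥ 0`. -/
structure IsC0Semigroup (S : ℝ≥0 → H →L[ℂ] H) : Prop where
  zero : S 0 = ContinuousLinearMap.id ℂ H
  add : ∀ s t : ℝ≥0, S (s + t) = (S s).comp (S t)
  continuous : ∀ x : H, Continuous fun t : ℝ≥0 => S t x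

/-- The operator with graph `G` is the infinitesimal generator of `S`: a pair `(x, y)` is in the
graph exactly when `(S t x - x) / t → y` as `t → 0+`. -/
def IsGenerator (S : ℝ≥0 → H →L[ℂ] H) (G : Submodule ℂ (H × H)) : Prop :=
  ∀ x y : H, (x, y) ∈ G ↔
    Tendsto (fun t : ℝ≥0 => (((t : ℝ) : ℂ))⁻¹ • (S t x - x)) (𝓝[>] 0) (𝓝 y)

/-- `A` has compact resolvent: for some `ρ`, the operator `ρ - A : D(A) → H` is bijective and
its inverse `R` is a compact operator on `H`. -/
def HasCompactResolvent (A : H →ₗ.[ℂ] H) : Prop :=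
  ∃ (ρ : ℂ) (R : H →L[ℂ] H), IsCompactOperator R ∧
    ∀ x y : H, R x = y ↔ ∃ hy : y ∈ A.domain, ρ • y - A ⟨y, hy⟩ = x

end Semigroups

variable {H : Type*} [NormedAddCommGroup H] [InnerProductSpace ℂ H] [CompleteSpace H]

/-- A self-adjoint or skew-adjoint operator with compact resolvent on
`H = H_1 ⊕ ... ⊕ H_m`, diagonal on each `H_i` with simple eigenvalues: `φ (i, n)`, `n : ℕ`, is an
orthonormal basis of `H_i` of eigenvectors with eigenvalues `ev i n`, so that `H_i` is the closed
linear span of the `φ (i, n)`. The index `n : ℕ` stands for the positive integer `n + 1`. -/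
structure DiagonalOperator (H : Type*) [NormedAddCommGroup H] [InnerProductSpace ℂ H]
    [CompleteSpace H] (m : ℕ) where
  op : H →ₗ.[ℂ] H
  dense_domain : Dense (op.domain : Set H)
  adjoint_eq : op.adjoint = op ∨ op.adjoint = -op
  compact_resolvent : HasCompactResolvent op
  φ : HilbertBasis (Fin m × ℕ) ℂ H
  ev : Fin m → ℕ → ℂ
  mem_domain : ∀ p, φ p ∈ op.domain
  op_apply : ∀ i n, op ⟨φ (i, n), mem_domain (i, n)⟩ = ev i n • φ (i, n)
  ev_injective : ∀ i, Function.Injective (ev i)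

namespace DiagonalOperator

variable {m : ℕ} (A : DiagonalOperator H m)

theorem mem_adjoint_domain (v : A.op.domain) : (v : H) ∈ A.op.adjoint.domain := by
  rcases A.adjoint_eq with h | h
  · rw [h]; exact v.2
  · rw [h]; exact v.2

/-- The vector `A* v` for `v ∈ D(A) = D(A*)`. -/
noncomputable def adj : A.op.domain →ₗ[ℂ] H :=
  A.op.adjoint.toFun.comp
    (A.op.domain.subtype.codRestrict A.op.adjoint.domain A.mem_adjoint_domain)

theorem norm_adj (v : A.op.domain) : ‖A.adj v‖ = ‖A.op v‖ := by
  have key : ∀ (B : H →ₗ.[ℂ] H), A.op.adjoint = B → (hv : (v : H) ∈ B.domain) →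
      A.adj v = B ⟨v, hv⟩ := by
    intro B hB hv
    subst hB
    rfl
  rcases A.adjoint_eq with h | h
  · rw [key _ h v.2]
  · rw [key _ h v.2, LinearPMap.neg_apply, norm_neg]
    rfl

/-- The space `D(A)'` (pivot space `H`): antilinear functionals on `D(A)` that are bounded for
the graph norm. -/
def Dual : Submodule ℂ (A.op.domain →ₗ⋆[ℂ] ℂ) where
  carrier := {l | ∃ C : ℝ, ∀ v : A.op.domain, ‖l v‖ ≤ C * (‖(v : H)‖ + ‖A.op v‖)}
  zero_mem' := ⟨0, fun v => by simp⟩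
  add_mem' := by
    rintro l₁ l₂ ⟨C₁, h₁⟩ ⟨C₂, h₂⟩
    refine ⟨C₁ + C₂, fun v => ?_⟩
    calc ‖(l₁ + l₂) v‖ ≤ ‖l₁ v‖ + ‖l₂ v‖ := norm_add_le _ _
      _ ≤ (C₁ + C₂) * (‖(v : H)‖ + ‖A.op v‖) := by rw [add_mul]; exact add_le_add (h₁ v) (h₂ v)
  smul_mem' := by
    rintro a l ⟨C, h⟩
    refine ⟨‖a‖ * C, fun v => ?_⟩
    rw [LinearMap.smul_apply, smul_eq_mul, norm_mul, mul_assoc]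
    exact mul_le_mul_of_nonneg_left (h v) (norm_nonneg _)

/-- The embedding `H ⊂ D(A)'`, `x ↦ ⟨x, ·⟩` (Mathlib's inner product is linear in its second
argument). -/
noncomputable def pivot : H →ₗ[ℂ] A.Dual where
  toFun x :=
    ⟨{ toFun := fun v => inner ℂ (v : H) x
       map_add' := fun v w => by simp
       map_smul' := fun a v => by simp [mul_comm] },
      ‖x‖, fun v => (norm_inner_le_norm _ _).trans (by
        rw [mul_comm]
        exact mul_le_mul_of_nonneg_left (le_add_of_nonneg_right (norm_nonneg _))
          (norm_nonneg _))⟩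
  map_add' x y := by ext v; simp
  map_smul' a x := by ext v; simp

/-- The extension `A : H → D(A)'` of `A`, `⟨A x, v⟩ = ⟨x, A* v⟩` for `v ∈ D(A)`. -/
noncomputable def extend : H →ₗ[ℂ] A.Dual where
  toFun x :=
    ⟨{ toFun := fun v => inner ℂ (A.adj v) x
       map_add' := fun v w => by simp
       map_smul' := fun a v => by simp [mul_comm] },
      ‖x‖, fun v => (norm_inner_le_norm _ _).trans (by
        rw [mul_comm, norm_adj]
        exact mul_le_mul_of_nonneg_left (le_add_of_nonneg_left (norm_nonneg _))
          (norm_nonneg _))⟩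
  map_add' x y := by ext v; simp
  map_smul' a x := by ext v; simp

/-- The weight `(1 + |λ_{i,n}|²)^s`. It is equivalent to `|λ_{i,n}|^{2s}` up to the zero
eigenvalues. -/
noncomputable def weight (s : ℝ) (p : Fin m × ℕ) : ℝ := (1 + ‖A.ev p.1 p.2‖ ^ 2) ^ s

theorem weight_nonneg (s : ℝ) (p : Fin m × ℕ) : 0 ≤ A.weight s p :=
  Real.rpow_nonneg (by positivity) _

/-- The space `D(A^s)`, `s ≥ 0`, that is `D(|A|^s)`. -/
def DomPow (s : ℝ) : Submodule ℂ H where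
  carrier := {f | Summable fun p => A.weight s p * ‖inner ℂ (A.φ p) f‖ ^ 2}
  zero_mem' := by simp
  add_mem' := by
    intro f g hf hg
    refine Summable.of_nonneg_of_le
      (fun p => mul_nonneg (A.weight_nonneg s p) (by positivity)) (fun p => ?_)
      ((hf.add hg).mul_left 2)
    have h1 : ‖inner ℂ (A.φ p) (f + g)‖ ≤ ‖inner ℂ (A.φ p) f‖ + ‖inner ℂ (A.φ p) g‖ := by
      rw [inner_add_right]; exact norm_add_le _ _
    have h2 : ‖inner ℂ (A.φ p) (f + g)‖ ^ 2
        ≤ 2 * (‖inner ℂ (A.φ p) f‖ ^ 2 + ‖inner ℂ (A.φ p) g‖ ^ 2) := by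
      nlinarith [norm_nonneg (inner ℂ (A.φ p) (f + g)),
        sq_nonneg (‖inner ℂ (A.φ p) f‖ - ‖inner ℂ (A.φ p) g‖)]
    nlinarith [mul_le_mul_of_nonneg_left h2 (A.weight_nonneg s p)]
  smul_mem' := by
    intro a f hf
    refine (hf.mul_left (‖a‖ ^ 2)).congr fun p => ?_
    rw [inner_smul_right, norm_mul]
    ring

/-- The norm of `D(A^s)`, equivalent to the graph norm of `|A|^s`. -/
noncomputable def powNorm (s : ℝ) (f : H) : ℝ :=
  Real.sqrt (∑' p, A.weight s p * ‖inner ℂ (A.φ p) f‖ ^ 2)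

/-- The space `D(A^r)' ⊂ D(A)'` for `0 ≤ r ≤ 1`: the functionals that are bounded for the norm of
`D(A^r)`. (`D(A)` is dense in `D(A^r)`, so they are the elements of the dual of `D(A^r)`.) -/
def DualPow (r : ℝ) : Submodule ℂ A.Dual where
  carrier := {l | ∃ C : ℝ, ∀ v : A.op.domain, ‖l.1 v‖ ≤ C * A.powNorm r v}
  zero_mem' := ⟨0, fun v => by simp⟩
  add_mem' := by
    rintro l₁ l₂ ⟨C₁, h₁⟩ ⟨C₂, h₂⟩
    refine ⟨C₁ + C₂, fun v => ?_⟩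
    calc ‖(l₁ + l₂).1 v‖ ≤ ‖l₁.1 v‖ + ‖l₂.1 v‖ := norm_add_le _ _
      _ ≤ (C₁ + C₂) * A.powNorm r v := by rw [add_mul]; exact add_le_add (h₁ v) (h₂ v)
  smul_mem' := by
    rintro a l ⟨C, h⟩
    refine ⟨‖a‖ * C, fun v => ?_⟩
    calc ‖(a • l).1 v‖ = ‖a‖ * ‖l.1 v‖ := by simp
      _ ≤ ‖a‖ * C * A.powNorm r v := by
        rw [mul_assoc]; exact mul_le_mul_of_nonneg_left (h v) (norm_nonneg _)

/-- `T'` is the extension of `T` to a bounded operator of `D(A^r)'`. Since `H` is dense in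
`D(A^r)'`, there is at most one such extension. -/
structure IsExtension (T : H →L[ℂ] H) (r : ℝ) (T' : A.DualPow r →ₗ[ℂ] A.DualPow r) : Prop where
  bounded : ∃ M : ℝ, ∀ (l : A.DualPow r) (C : ℝ),
    (∀ v : A.op.domain, ‖l.1.1 v‖ ≤ C * A.powNorm r v) →
      ∀ v : A.op.domain, ‖(T' l).1.1 v‖ ≤ M * C * A.powNorm r v
  extends_op : ∀ (l : A.DualPow r) (x : H),
    (l : A.Dual) = A.pivot x → (T' l : A.Dual) = A.pivot (T x)

variable {U : Type*} [NormedAddCommGroup U] [NormedSpace ℂ U]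

/-- `T B = B` in `D(A)'`: for some `0 ≤ r ≤ 1`, the operator `T` extends to a bounded operator of
`D(A^r)' ⊂ D(A)'`, the range of `B` lies in `D(A^r)'`, and the extension of `T` fixes it. -/
def FixesControl (T : H →L[ℂ] H) (B : U →ₗ[ℂ] A.Dual) : Prop :=
  ∃ r : ℝ, 0 ≤ r ∧ r ≤ 1 ∧ ∃ T' : A.DualPow r →ₗ[ℂ] A.DualPow r, A.IsExtension T r T' ∧
    ∀ u : U, ∃ hu : B u ∈ A.DualPow r, (T' ⟨B u, hu⟩ : A.Dual) = B u

/-- The coefficient `b_{i,n} = ⟨B e_i, φ_{i,n}⟩`. -/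
noncomputable def coeff (e : Module.Basis (Fin m) ℂ U) (B : U →ₗ[ℂ] A.Dual) (i : Fin m)
    (n : ℕ) : ℂ :=
  (B (e i)).1 ⟨A.φ (i, n), A.mem_domain (i, n)⟩

/-- The remaining assumptions: `A` generates a strongly continuous semigroup, the `i`-th control acts on `H_i` only, the
coefficients `b_{i,n}` are bounded and bounded away from `0`, and the eigenvalues are localized. -/
structure Framework (α : ℝ) (e : Module.Basis (Fin m) ℂ U) (B : U →ₗ[ℂ] A.Dual) : Prop where
  generates : ∃ S : ℝ≥0 → H →L[ℂ] H, IsC0Semigroup S ∧ IsGenerator S A.op.graph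
  block : ∀ i j n, i ≠ j → (B (e i)).1 ⟨A.φ (j, n), A.mem_domain (j, n)⟩ = 0
  control : ∃ c C : ℝ, 0 < c ∧ ∀ i n, c ≤ ‖A.coeff e B i n‖ ∧ ‖A.coeff e B i n‖ ≤ C
  one_lt : 1 < α
  consecutive : ∃ c C : ℝ, 0 < c ∧ ∀ (i : Fin m) (n : ℕ),
    c * ((n : ℝ) + 1) ^ (α - 1) ≤ ‖A.ev i (n + 1) - A.ev i n‖ ∧
      ‖A.ev i (n + 1) - A.ev i n‖ ≤ C * ((n : ℝ) + 1) ^ (α - 1)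
  gap : ∃ c : ℝ, 0 < c ∧ ∀ (i : Fin m) (k n : ℕ),
    c * ((k : ℝ) + 1) ^ (α - 1) * |(k : ℝ) - n| ≤ ‖A.ev i k - A.ev i n‖

/-- `μ` is not a difference of two eigenvalues of the same block. -/
def NonResonant (μ : ℝ) : Prop := ∀ i k n, (μ : ℂ) ≠ A.ev i k - A.ev i n

/-- The product over `m ≠ n` of `1 + μ / (λ_{i,n} - λ_{i,m})`. -/
noncomputable def prodPlus (μ : ℝ) (i : Fin m) (n : ℕ) : ℂ :=
  ∏' k : {k : ℕ // k ≠ n}, (1 + (μ : ℂ) / (A.ev i n - A.ev i k))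

/-- The product over `m ≠ n` of `1 - μ / (λ_{i,n} - λ_{i,m})`. -/
noncomputable def prodMinus (μ : ℝ) (i : Fin m) (n : ℕ) : ℂ :=
  ∏' k : {k : ℕ // k ≠ n}, (1 - (μ : ℂ) / (A.ev i n - A.ev i k))

/-- The entries of the inverse of the infinite Cauchy matrix `1 / (λ_{i,n} - λ_{i,j} - μ)`. -/
noncomputable def cauchyInv (μ : ℝ) (i : Fin m) (n j : ℕ) : ℂ :=
  (μ : ℂ) ^ 2 / (A.ev i j - A.ev i n - μ) * A.prodPlus μ i n * A.prodMinus μ i j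

/-- The feedback coefficients `k_{i,n}`, given by `k_{i,n} b_{i,n} = ∑ j, cauchyInv μ i n j`. -/
noncomputable def gain (e : Module.Basis (Fin m) ℂ U) (B : U →ₗ[ℂ] A.Dual) (μ : ℝ) (i : Fin m)
    (n : ℕ) : ℂ :=
  (∑' j, A.cauchyInv μ i n j) / A.coeff e B i n

/-- The infinite products and series in the definition of `gain` converge. -/
def GainConverges (μ : ℝ) : Prop :=
  ∀ i n, (Multipliable fun k : {k : ℕ // k ≠ n} => (1 + (μ : ℂ) / (A.ev i n - A.ev i k))) ∧
    (Multipliable fun k : {k : ℕ // k ≠ n} => (1 - (μ : ℂ) / (A.ev i n - A.ev i k))) ∧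
    Summable fun j => A.cauchyInv μ i n j

/-- `K` is the feedback with `K φ_{i,n} = k_{i,n} e_i`. It is defined on the union of the
(nested) spaces `D(A^s)`, `s > 1 / (2 α)`, and is continuous on each of them. -/
structure IsFeedback (α : ℝ) (e : Module.Basis (Fin m) ℂ U) (B : U →ₗ[ℂ] A.Dual) (μ : ℝ)
    (K : H →ₗ.[ℂ] U) : Prop where
  domain_eq : K.domain = ⨆ (s : ℝ) (_ : 1 / (2 * α) < s), A.DomPow s
  bounded : ∀ s : ℝ, 1 / (2 * α) < s → ∃ C : ℝ, ∀ f : K.domain, (f : H) ∈ A.DomPow s →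
    ‖K f‖ ≤ C * A.powNorm s f
  apply_basis : ∀ i n, (A.φ (i, n), A.gain e B μ i n • e i) ∈ K.graph

/-- `T φ_{i,n} = k_{i,n} (A - (λ_{i,n} + μ))⁻¹ B e_i`, expanded in the eigenbasis. -/
def IsTransform (e : Module.Basis (Fin m) ℂ U) (B : U →ₗ[ℂ] A.Dual) (μ : ℝ)
    (T : H →L[ℂ] H) : Prop :=
  ∀ i n, HasSum
    (fun j => (A.gain e B μ i n * (A.coeff e B i j / (A.ev i j - A.ev i n - μ))) • A.φ (i, j))
    (T (A.φ (i, n)))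

/-- The graph of `A + B K` in `H`: its domain consists of the `f` in the domain of `K` for which
`A f + B K f`, computed in `D(A)'`, belongs to `H`. -/
def closedLoop (B : U →ₗ[ℂ] A.Dual) (K : H →ₗ.[ℂ] U) : Submodule ℂ (H × H) where
  carrier := {x | ∃ hx : x.1 ∈ K.domain, A.extend x.1 + B (K ⟨x.1, hx⟩) = A.pivot x.2}
  zero_mem' := ⟨K.domain.zero_mem, by
    have : K ⟨(0 : H × H).1, K.domain.zero_mem⟩ = 0 := K.map_zero
    rw [this]; simp⟩
  add_mem' := by
    rintro x y ⟨hx, ex⟩ ⟨hy, ey⟩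
    refine ⟨K.domain.add_mem hx hy, ?_⟩
    have : K ⟨(x + y).1, K.domain.add_mem hx hy⟩ = K ⟨x.1, hx⟩ + K ⟨y.1, hy⟩ :=
      K.map_add ⟨x.1, hx⟩ ⟨y.1, hy⟩
    rw [this, Prod.fst_add, Prod.snd_add, map_add, map_add, map_add, ← ex, ← ey]
    abel
  smul_mem' := by
    rintro a x ⟨hx, ex⟩
    refine ⟨K.domain.smul_mem a hx, ?_⟩
    have : K ⟨(a • x).1, K.domain.smul_mem a hx⟩ = a • K ⟨x.1, hx⟩ := K.map_smul a ⟨x.1, hx⟩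
    rw [this, Prod.smul_fst, Prod.smul_snd, map_smul, map_smul, map_smul, ← ex, smul_add]

end DiagonalOperator

end Backstepping

/-! Within a block, the matrix of `T` in the eigenbasis is `T_{jn} = k_n b_j / (λ_j - λ_n - μ)`, a
Cauchy matrix between two diagonal ones. The intertwining relation is then the entrywise identity
`(λ_j - μ) T_{jn} - T_{jn} λ_n = b_j k_n`, and `T B = B` says that `∑ n, k_n b_n / (λ_j - λ_n - μ) =
1` for every `j`. The explicit inverse of the Cauchy matrix solves this system: its row sums
collapse to `k_n b_n = -μ ∏ (1 + μ / (λ_n - λ_k))`.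

For finite sets of nodes these identities are partial fraction expansions, proved by Lagrange
interpolation (`sum_shift_div`, `sum_cauchy_orthogonal`). They pass to infinitely many nodes by
dominated convergence (`hasSum_of_tendsto_sum`): since `∑ k, 1 / |λ_j - λ_k|` is bounded uniformly
in `j`, all partial products are bounded by one constant. The same bound makes the gains bounded.

The gap condition gives `|λ_j - λ_n| ≥ c |j - n| ^ α`. As `α > 1` and `μ` is non-resonant, the rows
and columns of `1 / (λ_j - λ_n - μ)` are uniformly summable, so the Schur test bounds `T` and its
explicit inverse (`exists_transform`). For `T B = B` one works in `D(A^{1/2})'`: conjugating `T` by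
`(1 + |λ|²)^{1/4}` changes it by a bounded matrix (`exists_weighted_transform`), and this space
contains the range of `B` because `1 / (2 α) < 1 / 2`.

Finally `A + B K = T⁻¹ (A - μ) T`, domains included (`mem_closedLoop_iff`), so the closed loop
generates `T⁻¹ e^{-μ t} S t T`. If `‖S t‖ ≤ M e^{ω t}`, this decays at rate `μ - ω`. Resonances are
countable, so `μ` can be chosen as large as desired. -/

namespace Backstepping

open Filter Topology
open scoped NNReal

/-! ### Cauchy matrix identities, for finitely and then infinitely many nodes. -/

section CauchyMatrix

theorem nodalWeight_mul_prod_sub (s : Finset ℕ) {l : ℕ → ℂ} (hl : Function.Injective l) (μ : ℂ)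
    (j : ℕ) (hj : j ∈ s) :
    Lagrange.nodalWeight s l j * ∏ k ∈ s.erase j, (l j - (l k + μ)) =
      ∏ k ∈ s, (1 - μ / (l j - l k)) := by
  rw [Lagrange.nodalWeight, ← Finset.prod_mul_distrib, ← Finset.mul_prod_erase s _ hj]
  simp only [sub_self, div_zero, sub_zero, one_mul]
  refine Finset.prod_congr rfl fun k hk => ?_
  have : l j - l k ≠ 0 := sub_ne_zero.2 fun h => (Finset.ne_of_mem_erase hk) (hl h).symm
  field_simp
  ring

/-- The partial fraction expansion of `∏ k ∈ s, (z - l k - μ) / (z - l k)`. -/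
theorem sum_shift_div (s : Finset ℕ) {l : ℕ → ℂ} (hl : Function.Injective l) (μ z : ℂ)
    (hz : ∀ j ∈ s, z ≠ l j) :
    ∑ j ∈ s, μ * (∏ k ∈ s, (1 - μ / (l j - l k))) / (z - l j) =
      1 - ∏ k ∈ s, (1 - μ / (z - l k)) := by
  -- Both nodal polynomials are monic of degree `s.card`, so the leading terms cancel and Lagrange
  -- interpolation of the difference at the nodes is exact.
  have hdeg : (Lagrange.nodal s l - Lagrange.nodal s (fun k => l k + μ)).degree < s.card := by
    rw [← Lagrange.degree_nodal (R := ℂ) (s := s) (v := l)]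
    refine Polynomial.degree_sub_lt_left ?_ Lagrange.nodal_ne_zero ?_
    · rw [Lagrange.degree_nodal, Lagrange.degree_nodal]
    · rw [Lagrange.nodal_monic.leadingCoeff, Lagrange.nodal_monic.leadingCoeff]
  have h := congrArg (Polynomial.eval z) (Lagrange.eq_interpolate hl.injOn hdeg)
  rw [Lagrange.eval_interpolate_not_at_node _ hz] at h
  have hne : Polynomial.eval z (Lagrange.nodal s l) ≠ 0 := by
    rw [Lagrange.eval_nodal]
    exact Finset.prod_ne_zero_iff.2 fun j hj => sub_ne_zero.2 (hz j hj)
  have hprod : ∏ k ∈ s, (1 - μ / (z - l k)) =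
      Polynomial.eval z (Lagrange.nodal s fun k => l k + μ) /
        Polynomial.eval z (Lagrange.nodal s l) := by
    rw [Lagrange.eval_nodal, Lagrange.eval_nodal, ← Finset.prod_div_distrib]
    refine Finset.prod_congr rfl fun k hk => ?_
    have := sub_ne_zero.2 (hz k hk)
    field_simp
    ring
  rw [hprod, one_sub_div hne, eq_div_iff hne, ← Polynomial.eval_sub, h, mul_comm]
  congr 1
  refine Finset.sum_congr rfl fun j hj => ?_
  rw [Polynomial.eval_sub, Lagrange.eval_nodal_at_node hj, Lagrange.eval_nodal,
    ← nodalWeight_mul_prod_sub s hl μ j hj, ← Finset.mul_prod_erase s _ hj]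
  have := sub_ne_zero.2 (hz j hj)
  field_simp
  ring

/-- The partial fraction expansion of
`(z - l n - μ)⁻¹ * ∏ k ∈ s, (z - l k - μ) / (z - l k)`. -/
theorem sum_shift_div_mul (s : Finset ℕ) {l : ℕ → ℂ} (hl : Function.Injective l) {μ : ℂ}
    (hμ : ∀ k n, μ ≠ l k - l n) {n : ℕ} (hn : n ∈ s) (z : ℂ) (hz : ∀ j ∈ s, z ≠ l j) :
    ∑ j ∈ s, -μ * (∏ k ∈ s, (1 - μ / (l j - l k))) / ((l j - l n - μ) * (z - l j)) =
      (∏ k ∈ s.erase n, (z - (l k + μ))) / ∏ k ∈ s, (z - l k) := by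
  have hdeg : (Lagrange.nodal (s.erase n) (fun k => l k + μ)).degree < s.card := by
    rw [Lagrange.degree_nodal, Nat.cast_lt]
    exact Finset.card_erase_lt_of_mem hn
  have h := congrArg (Polynomial.eval z) (Lagrange.eq_interpolate hl.injOn hdeg)
  rw [Lagrange.eval_interpolate_not_at_node _ hz] at h
  have hne : ∏ k ∈ s, (z - l k) ≠ 0 :=
    Finset.prod_ne_zero_iff.2 fun j hj => sub_ne_zero.2 (hz j hj)
  rw [Lagrange.eval_nodal, Lagrange.eval_nodal] at h
  rw [eq_div_iff hne, h, mul_comm]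
  congr 1
  refine Finset.sum_congr rfl fun j hj => ?_
  have h1 := sub_ne_zero.2 (hz j hj)
  have h2 : l j - l n - μ ≠ 0 := sub_ne_zero.2 (hμ j n).symm
  -- Both sides equal the full product over `s`, with the factor of `n` split off on the left and
  -- the factor of `j`, which is `-μ`, on the right.
  have h3 : (∏ k ∈ s.erase n, (l j - (l k + μ))) * (l j - l n - μ) =
      -μ * ∏ k ∈ s.erase j, (l j - (l k + μ)) := by
    have a := Finset.mul_prod_erase s (fun k => l j - (l k + μ)) hn
    have b := Finset.mul_prod_erase s (fun k => l j - (l k + μ)) hj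
    linear_combination a - b
  rw [Lagrange.eval_nodal, ← nodalWeight_mul_prod_sub s hl μ j hj]
  field_simp
  linear_combination (-Lagrange.nodalWeight s l j) * h3

/-- This is `sum_shift_div_mul` at `z = l k + μ`. For `n ≠ k` the numerator keeps the vanishing
factor of index `k`; for `n = k` that factor has been removed and the remaining products cancel. -/
theorem sum_cauchy_orthogonal (s : Finset ℕ) {l : ℕ → ℂ} (hl : Function.Injective l) {μ : ℂ}
    (hμ : ∀ k n, μ ≠ l k - l n) {n k : ℕ} (hn : n ∈ s) (hk : k ∈ s) :
    ∑ j ∈ s, μ ^ 2 * (∏ i ∈ s, (1 - μ / (l j - l i))) * (∏ i ∈ s, (1 - -μ / (l n - l i))) /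
      ((l j - l n - μ) * (l j - l k - μ)) = if n = k then 1 else 0 := by
  have hz : ∀ j ∈ s, l k + μ ≠ l j := fun j _ h => hμ j k (by rw [← h]; ring)
  have h := sum_shift_div_mul s hl hμ hn (l k + μ) hz
  have h0 : μ ≠ 0 := by simpa using hμ n n
  have e : ∑ j ∈ s, μ ^ 2 * (∏ i ∈ s, (1 - μ / (l j - l i))) *
      (∏ i ∈ s, (1 - -μ / (l n - l i))) / ((l j - l n - μ) * (l j - l k - μ)) =
      μ * (∏ i ∈ s, (1 - -μ / (l n - l i))) * ∑ j ∈ s, -μ * (∏ k ∈ s, (1 - μ / (l j - l k))) /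
        ((l j - l n - μ) * (l k + μ - l j)) := by
    rw [Finset.mul_sum]
    refine Finset.sum_congr rfl fun j hj => ?_
    have h1 : l k + μ - l j ≠ 0 := sub_ne_zero.2 (hz j hj)
    have h2 : l j - l n - μ ≠ 0 := sub_ne_zero.2 (hμ j n).symm
    have h3 : l j - l k - μ ≠ 0 := sub_ne_zero.2 (hμ j k).symm
    field_simp
    ring
  rw [e, h]
  split_ifs with hnk
  · subst hnk
    have e1 : ∏ i ∈ s, (1 - -μ / (l n - l i)) =
        ∏ i ∈ s.erase n, ((l n + μ - l i) / (l n - l i)) := by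
      rw [← Finset.mul_prod_erase s _ hn]
      simp only [sub_self, div_zero, sub_zero, one_mul]
      refine Finset.prod_congr rfl fun i hi => ?_
      have : l n - l i ≠ 0 := sub_ne_zero.2 fun h => (Finset.ne_of_mem_erase hi) (hl h).symm
      field_simp
      ring
    have e2 : ∏ i ∈ s, (l n + μ - l i) = μ * ∏ i ∈ s.erase n, (l n + μ - l i) := by
      rw [← Finset.mul_prod_erase s _ hn]; ring
    have e3 : ∏ i ∈ s.erase n, (l n + μ - (l i + μ)) = ∏ i ∈ s.erase n, (l n - l i) :=
      Finset.prod_congr rfl fun i _ => by ring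
    have n1 : ∏ i ∈ s.erase n, (l n + μ - l i) ≠ 0 := Finset.prod_ne_zero_iff.2 fun i hi =>
      sub_ne_zero.2 (hz i (Finset.mem_of_mem_erase hi))
    have n2 : ∏ i ∈ s.erase n, (l n - l i) ≠ 0 := Finset.prod_ne_zero_iff.2 fun i hi =>
      sub_ne_zero.2 fun h => (Finset.ne_of_mem_erase hi) (hl h).symm
    rw [e1, Finset.prod_div_distrib, e2, e3]
    field_simp
  · have : ∏ i ∈ s.erase n, (l k + μ - (l i + μ)) = 0 :=
      Finset.prod_eq_zero (Finset.mem_erase.2 ⟨Ne.symm hnk, hk⟩) (sub_self _)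
    rw [this]; simp

/-- The product over `k ≠ j` of `1 - μ / (l j - l k)` (the factor with `k = j` is `1`). -/
noncomputable def shiftProd (l : ℕ → ℂ) (μ : ℂ) (j : ℕ) : ℂ := ∏' k, (1 - μ / (l j - l k))

variable {l : ℕ → ℂ} {R : ℝ}

theorem multipliable_shift (hR : ∀ j, ∀ s : Finset ℕ, ∑ k ∈ s, ‖(l j - l k)⁻¹‖ ≤ R) (μ : ℂ)
    (j : ℕ) : Multipliable fun k => 1 - μ / (l j - l k) := by
  have h : Summable fun k => ‖(l j - l k)⁻¹‖ :=
    summable_of_sum_le (fun _ => norm_nonneg _) (hR j)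
  have h2 : Summable fun k => ‖-(μ / (l j - l k))‖ := by
    refine (h.mul_left ‖μ‖).congr fun k => ?_
    rw [norm_neg, div_eq_mul_inv, norm_mul]
  simpa [sub_eq_add_neg] using multipliable_one_add_of_summable h2

theorem norm_prod_shift_le (hR : ∀ j, ∀ s : Finset ℕ, ∑ k ∈ s, ‖(l j - l k)⁻¹‖ ≤ R) (μ : ℂ)
    (j : ℕ) (s : Finset ℕ) : ‖∏ k ∈ s, (1 - μ / (l j - l k))‖ ≤ Real.exp (‖μ‖ * R) := by
  calc ‖∏ k ∈ s, (1 - μ / (l j - l k))‖ ≤ ∏ k ∈ s, (1 + ‖μ‖ * ‖(l j - l k)⁻¹‖) := by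
        rw [norm_prod]
        refine Finset.prod_le_prod (fun _ _ => norm_nonneg _) fun k _ => ?_
        refine (norm_sub_le _ _).trans (le_of_eq ?_)
        rw [norm_one, div_eq_mul_inv, norm_mul]
    _ ≤ Real.exp (∑ k ∈ s, ‖μ‖ * ‖(l j - l k)⁻¹‖) :=
        Real.prod_one_add_le_exp_sum _ fun _ => by positivity
    _ ≤ Real.exp (‖μ‖ * R) := by
        rw [← Finset.mul_sum]
        exact Real.exp_le_exp.2 (mul_le_mul_of_nonneg_left (hR j s) (norm_nonneg _))

theorem norm_shiftProd_le (hR : ∀ j, ∀ s : Finset ℕ, ∑ k ∈ s, ‖(l j - l k)⁻¹‖ ≤ R) (μ : ℂ)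
    (j : ℕ) : ‖shiftProd l μ j‖ ≤ Real.exp (‖μ‖ * R) :=
  le_of_tendsto ((continuous_norm.tendsto _).comp (multipliable_shift hR μ j).hasProd)
    (Eventually.of_forall (norm_prod_shift_le hR μ j))

/-- Dominated convergence when the range of summation and the summand depend on the same finite set
`s`: the summand is extended by zero outside `s`. -/
theorem hasSum_of_tendsto_sum {f : ℕ → ℂ} {F : Finset ℕ → ℕ → ℂ} {b : ℕ → ℝ} {c : ℂ}
    (hb : Summable b) (hF : ∀ j, Tendsto (F · j) atTop (𝓝 (f j))) (hFb : ∀ s j, ‖F s j‖ ≤ b j)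
    (hc : Tendsto (fun s => ∑ j ∈ s, F s j) atTop (𝓝 c)) : HasSum f c := by
  have hf : Summable f := Summable.of_norm_bounded hb fun j =>
    le_of_tendsto (hF j).norm (Eventually.of_forall fun s => hFb s j)
  have key : Tendsto (fun s : Finset ℕ => ∑' j, if j ∈ s then F s j else 0) atTop
      (𝓝 (∑' j, f j)) := by
    refine tendsto_tsum_of_dominated_convergence hb (fun j => ?_)
      (Eventually.of_forall fun s j => ?_)
    · refine (hF j).congr' ?_
      filter_upwards [eventually_ge_atTop {j}] with s hs
      rw [if_pos (hs (Finset.mem_singleton_self j))]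
    · split_ifs
      · exact hFb s j
      · rw [norm_zero]; exact (norm_nonneg _).trans (hFb s j)
  have e : (fun s : Finset ℕ => ∑' j, if j ∈ s then F s j else 0) =
      fun s => ∑ j ∈ s, F s j := by
    funext s
    rw [tsum_eq_sum (s := s) fun j hj => if_neg hj]
    exact Finset.sum_congr rfl fun j hj => if_pos hj
  rw [e] at key
  rw [tendsto_nhds_unique hc key]
  exact hf.hasSum

theorem hasSum_shiftProd_div (hl : Function.Injective l)
    (hR : ∀ j, ∀ s : Finset ℕ, ∑ k ∈ s, ‖(l j - l k)⁻¹‖ ≤ R) {μ : ℂ} (hμ : ∀ k n, μ ≠ l k - l n)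
    (n : ℕ) (hs : Summable fun j => ‖(l n + μ - l j)⁻¹‖) :
    HasSum (fun j => μ * shiftProd l μ j / (l n + μ - l j)) 1 := by
  have hz : ∀ j, l n + μ ≠ l j := fun j h => hμ j n (by rw [← h]; ring)
  refine hasSum_of_tendsto_sum
    (F := fun s j => μ * (∏ k ∈ s, (1 - μ / (l j - l k))) / (l n + μ - l j))
    (hs.mul_left (‖μ‖ * Real.exp (‖μ‖ * R))) (fun j => ?_) (fun s j => ?_) ?_
  · exact ((multipliable_shift hR μ j).hasProd.const_mul μ).div_const _
  · rw [div_eq_mul_inv, norm_mul, norm_mul]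
    gcongr
    exact norm_prod_shift_le hR μ j s
  · refine tendsto_const_nhds.congr' ?_
    filter_upwards [eventually_ge_atTop {n}] with s hns
    have hn : n ∈ s := hns (Finset.mem_singleton_self n)
    have h0 : μ ≠ 0 := by simpa using hμ n n
    -- At `z = l n + μ` the factor of index `n` is `1 - μ / μ = 0`, so the finite sums equal `1`
    -- exactly once `n ∈ s`.
    rw [sum_shift_div s hl μ _ fun j _ => hz j, Finset.prod_eq_zero hn, sub_zero]
    rw [add_sub_cancel_left, div_self h0, sub_self]

theorem hasSum_cauchy_orthogonal (hl : Function.Injective l)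
    (hR : ∀ j, ∀ s : Finset ℕ, ∑ k ∈ s, ‖(l j - l k)⁻¹‖ ≤ R) {μ : ℂ} (hμ : ∀ k n, μ ≠ l k - l n)
    (n k : ℕ) (hs : Summable fun j => ‖((l j - l n - μ) * (l j - l k - μ))⁻¹‖) :
    HasSum (fun j => μ ^ 2 * shiftProd l μ j * shiftProd l (-μ) n /
      ((l j - l n - μ) * (l j - l k - μ))) (if n = k then 1 else 0) := by
  refine hasSum_of_tendsto_sum
    (F := fun s j => μ ^ 2 * (∏ i ∈ s, (1 - μ / (l j - l i))) *
      (∏ i ∈ s, (1 - -μ / (l n - l i))) / ((l j - l n - μ) * (l j - l k - μ)))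
    (hs.mul_left (‖μ ^ 2‖ * Real.exp (‖μ‖ * R) * Real.exp (‖-μ‖ * R))) (fun j => ?_)
    (fun s j => ?_) ?_
  · exact (((multipliable_shift hR μ j).hasProd.const_mul _).mul
      (multipliable_shift hR (-μ) n).hasProd).div_const _
  · rw [div_eq_mul_inv, norm_mul, norm_mul, norm_mul]
    gcongr
    · exact norm_prod_shift_le hR μ j s
    · exact norm_prod_shift_le hR (-μ) n s
  · refine tendsto_const_nhds.congr' ?_
    filter_upwards [eventually_ge_atTop {n, k}] with s hns
    exact (sum_cauchy_orthogonal s hl hμ (hns (by simp)) (hns (by simp))).symm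

end CauchyMatrix

/-! ### Bounded operators from infinite block matrices. -/

section MatrixOperator

variable {ι H : Type*} [NormedAddCommGroup H] [InnerProductSpace ℂ H]

theorem hasSum_norm_inner_sq (φ : HilbertBasis ι ℂ H) (x : H) :
    HasSum (fun i => ‖inner ℂ (φ i) x‖ ^ 2) (‖x‖ ^ 2) := by
  have h := Complex.hasSum_re (φ.hasSum_inner_mul_inner x x)
  rw [inner_self_eq_norm_sq_to_K] at h
  convert! h using 1
  · funext i
    rw [← inner_conj_symm x (φ i), ← Complex.normSq_eq_conj_mul_self, Complex.ofReal_re,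
      Complex.normSq_eq_norm_sq]
  · norm_cast

theorem eq_of_forall_inner_eq (φ : HilbertBasis ι ℂ H) {x y : H}
    (h : ∀ i, inner ℂ (φ i) x = inner ℂ (φ i) y) : x = y := by
  refine φ.repr.injective (lp.ext (funext fun i => ?_))
  rw [φ.repr_apply_apply, φ.repr_apply_apply, h]

theorem inner_basis_eq_ite [DecidableEq ι] (φ : HilbertBasis ι ℂ H) (i j : ι) :
    inner ℂ (φ i) (φ j) = if i = j then 1 else 0 :=
  orthonormal_iff_ite.1 φ.orthonormal i j

theorem exists_inner_eq (φ : HilbertBasis ι ℂ H) {c : ι → ℂ} (hc : Summable fun i => ‖c i‖ ^ 2) :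
    ∃ y : H, ∀ i, inner ℂ (φ i) y = c i := by
  have hm : Memℓp c 2 := memℓp_gen (by simpa using hc)
  refine ⟨φ.repr.symm ⟨c, hm⟩, fun i => ?_⟩
  rw [← φ.repr_apply_apply, LinearIsometryEquiv.apply_symm_apply]

theorem clm_eq_of_forall_inner_eq (φ : HilbertBasis ι ℂ H) {S T : H →L[ℂ] H}
    (h : ∀ i j, inner ℂ (φ i) (S (φ j)) = inner ℂ (φ i) (T (φ j))) : S = T := by
  have hd : Dense (Submodule.span ℂ (Set.range φ) : Set H) :=
    Submodule.dense_iff_topologicalClosure_eq_top.2 φ.dense_span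
  refine ContinuousLinearMap.ext_on hd ?_
  rintro _ ⟨j, rfl⟩
  exact eq_of_forall_inner_eq φ fun i => h i j

/-- The Schur test with weights `p`, for finite sections. -/
theorem schur_test_finset {M : ι → ι → ℂ} {p : ι → ℝ} {R : ℝ} (hp : ∀ i, 0 < p i)
    (hrow : ∀ j, ∀ s : Finset ι, ∑ n ∈ s, ‖M j n‖ * p n ≤ R * p j)
    (hcol : ∀ n, ∀ s : Finset ι, ∑ j ∈ s, ‖M j n‖ * p j ≤ R * p n) (x : ι → ℝ)
    (F G : Finset ι) :
    ∑ j ∈ F, (∑ n ∈ G, ‖M j n‖ * x n) ^ 2 ≤ R ^ 2 * ∑ n ∈ G, x n ^ 2 := by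
  rcases G.eq_empty_or_nonempty with rfl | ⟨i, _⟩
  · simp
  have hR : 0 ≤ R := by
    have := hrow i ∅
    rw [Finset.sum_empty] at this
    exact nonneg_of_mul_nonneg_left this (hp i)
  calc ∑ j ∈ F, (∑ n ∈ G, ‖M j n‖ * x n) ^ 2
      ≤ ∑ j ∈ F, (R * p j) * ∑ n ∈ G, ‖M j n‖ * (x n ^ 2 / p n) := by
        refine Finset.sum_le_sum fun j _ => ?_
        have h0 : 0 ≤ ∑ n ∈ G, ‖M j n‖ * (x n ^ 2 / p n) := Finset.sum_nonneg fun n _ =>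
          mul_nonneg (norm_nonneg _) (div_nonneg (sq_nonneg _) (hp n).le)
        refine le_trans ?_ (mul_le_mul_of_nonneg_right (hrow j G) h0)
        -- Cauchy–Schwarz, with the square of each term split as `(‖M j n‖ * p n) * (‖M j n‖ * (x n
        -- ^ 2 / p n))`. The row bound controls the first factor; the column bound is used after
        -- exchanging the sums.
        refine Finset.sum_sq_le_sum_mul_sum_of_sq_le_mul _
          (fun n _ => mul_nonneg (norm_nonneg _) (hp n).le)
          (fun n _ => mul_nonneg (norm_nonneg _) (div_nonneg (sq_nonneg _) (hp n).le))
          fun n _ => le_of_eq ?_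
        have := (hp n).ne'
        field_simp
    _ = R * ∑ n ∈ G, (x n ^ 2 / p n) * ∑ j ∈ F, ‖M j n‖ * p j := by
        simp only [Finset.mul_sum]
        rw [Finset.sum_comm]
        refine Finset.sum_congr rfl fun n _ => Finset.sum_congr rfl fun j _ => ?_
        ring
    _ ≤ R * ∑ n ∈ G, (x n ^ 2 / p n) * (R * p n) := by
        refine mul_le_mul_of_nonneg_left (Finset.sum_le_sum fun n _ => ?_) hR
        exact mul_le_mul_of_nonneg_left (hcol n F) (div_nonneg (sq_nonneg _) (hp n).le)
    _ = R ^ 2 * ∑ n ∈ G, x n ^ 2 := by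
        rw [Finset.mul_sum, Finset.mul_sum]
        refine Finset.sum_congr rfl fun n _ => ?_
        have := (hp n).ne'
        field_simp

/-- A matrix that passes the Schur test defines a bounded operator. -/
theorem exists_clm_of_schur (φ : HilbertBasis ι ℂ H) {M : ι → ι → ℂ} {p : ι → ℝ}
    {R : ℝ} (hp : ∀ i, 0 < p i)
    (hrow : ∀ j, ∀ s : Finset ι, ∑ n ∈ s, ‖M j n‖ * p n ≤ R * p j)
    (hcol : ∀ n, ∀ s : Finset ι, ∑ j ∈ s, ‖M j n‖ * p j ≤ R * p n) :
    ∃ T : H →L[ℂ] H, ∀ x j, HasSum (fun n => M j n * inner ℂ (φ n) x) (inner ℂ (φ j) (T x)) := by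
  have bessel : ∀ (x : H) (G : Finset ι), ∑ n ∈ G, ‖inner ℂ (φ n) x‖ ^ 2 ≤ ‖x‖ ^ 2 :=
    fun x G => sum_le_hasSum G (fun _ _ => sq_nonneg _) (hasSum_norm_inner_sq φ x)
  have schur : ∀ (x : H) (F G : Finset ι),
      ∑ j ∈ F, (∑ n ∈ G, ‖M j n‖ * ‖inner ℂ (φ n) x‖) ^ 2 ≤ R ^ 2 * ‖x‖ ^ 2 := fun x F G =>
    (schur_test_finset hp hrow hcol _ F G).trans
      (mul_le_mul_of_nonneg_left (bessel x G) (sq_nonneg _))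
  have hsum : ∀ x j, Summable fun n => M j n * inner ℂ (φ n) x := by
    intro x j
    refine Summable.of_norm (summable_of_sum_le (c := |R| * ‖x‖) (fun _ => norm_nonneg _)
      fun G => ?_)
    have h := schur x {j} G
    rw [Finset.sum_singleton, ← mul_pow] at h
    simp only [norm_mul]
    calc _ ≤ |R * ‖x‖| := (le_abs_self _).trans (sq_le_sq.1 h)
      _ = _ := by rw [abs_mul, abs_of_nonneg (norm_nonneg x)]
  have hsq : ∀ x (F : Finset ι), ∑ j ∈ F, ‖∑' n, M j n * inner ℂ (φ n) x‖ ^ 2 ≤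
      R ^ 2 * ‖x‖ ^ 2 := by
    intro x F
    have ht : Tendsto (fun G : Finset ι => ∑ j ∈ F, ‖∑ n ∈ G, M j n * inner ℂ (φ n) x‖ ^ 2) atTop
        (𝓝 (∑ j ∈ F, ‖∑' n, M j n * inner ℂ (φ n) x‖ ^ 2)) :=
      tendsto_finsetSum _ fun j _ => ((continuous_norm.tendsto _).comp (hsum x j).hasSum).pow 2
    refine le_of_tendsto ht (Eventually.of_forall fun G => le_trans ?_ (schur x F G))
    refine Finset.sum_le_sum fun j _ => pow_le_pow_left₀ (norm_nonneg _) ?_ 2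
    exact (norm_sum_le _ _).trans (Finset.sum_le_sum fun n _ => (norm_mul _ _).le)
  have hex : ∀ x : H, ∃ y : H, ∀ j, inner ℂ (φ j) y = ∑' n, M j n * inner ℂ (φ n) x := fun x =>
    exists_inner_eq φ (summable_of_sum_le (fun _ => sq_nonneg _) (hsq x))
  choose T hT using hex
  let T₀ : H →ₗ[ℂ] H :=
    { toFun := T
      map_add' := fun x y => eq_of_forall_inner_eq φ fun j => by
        rw [inner_add_right, hT, hT, hT, ← (hsum x j).tsum_add (hsum y j)]
        exact tsum_congr fun n => by rw [inner_add_right, mul_add]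
      map_smul' := fun a x => eq_of_forall_inner_eq φ fun j => by
        rw [RingHom.id_apply, inner_smul_right, hT, hT, ← tsum_mul_left]
        exact tsum_congr fun n => by rw [inner_smul_right]; ring }
  have hb : ∀ x, ‖T₀ x‖ ≤ |R| * ‖x‖ := by
    intro x
    refine le_of_sq_le_sq ?_ (by positivity)
    rw [mul_pow, sq_abs]
    refine hasSum_le_of_sum_le (hasSum_norm_inner_sq φ (T₀ x)) fun F => ?_
    refine le_trans (le_of_eq (Finset.sum_congr rfl fun j _ => ?_)) (hsq x F)
    rw [← hT x j]; rfl
  refine ⟨T₀.mkContinuous |R| hb, fun x j => ?_⟩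
  have : inner ℂ (φ j) (T₀.mkContinuous |R| hb x) = ∑' n, M j n * inner ℂ (φ n) x := hT x j
  rw [this]
  exact (hsum x j).hasSum

theorem hasSum_mk_iff {κ E : Type*} [AddCommMonoid E] [TopologicalSpace E] {f : κ × ℕ → E}
    {i : κ} (hf : ∀ q, q.1 ≠ i → f q = 0) {s : E} :
    HasSum f s ↔ HasSum (fun n => f (i, n)) s := by
  refine (Function.Injective.hasSum_iff (g := fun n => (i, n)) (fun a b h => (Prod.ext_iff.1 h).2)
    fun q hq => hf q fun h => hq ⟨q.2, ?_⟩).symm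
  rw [← h]

theorem sum_le_of_block {κ : Type*} {f : κ × ℕ → ℝ} {i : κ} (hf0 : ∀ q, 0 ≤ f q)
    (hf : ∀ q, q.1 ≠ i → f q = 0) {R : ℝ} (hR : ∀ s : Finset ℕ, ∑ n ∈ s, f (i, n) ≤ R)
    (s : Finset (κ × ℕ)) : ∑ q ∈ s, f q ≤ R := by
  classical
  have h : Summable fun n => f (i, n) := summable_of_sum_le (fun _ => hf0 _) hR
  exact (sum_le_hasSum s (fun q _ => hf0 q) ((hasSum_mk_iff hf).2 h.hasSum)).trans
    (h.tsum_le_of_sum_le hR)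

variable {κ : Type*} [DecidableEq κ]

theorem exists_block_clm (φ : HilbertBasis (κ × ℕ) ℂ H) {t : κ → ℕ → ℕ → ℂ}
    {p : κ × ℕ → ℝ} {R : ℝ} (hp : ∀ q, 0 < p q)
    (hrow : ∀ i j, ∀ s : Finset ℕ, ∑ n ∈ s, ‖t i j n‖ * p (i, n) ≤ R * p (i, j))
    (hcol : ∀ i n, ∀ s : Finset ℕ, ∑ j ∈ s, ‖t i j n‖ * p (i, j) ≤ R * p (i, n)) :
    ∃ T : H →L[ℂ] H, ∀ x i j,
      HasSum (fun n => t i j n * inner ℂ (φ (i, n)) x) (inner ℂ (φ (i, j)) (T x)) := by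
  obtain ⟨T, hT⟩ := exists_clm_of_schur φ
    (M := fun q r => if r.1 = q.1 then t q.1 q.2 r.2 else 0) (p := p) (R := R) hp
    (fun q s => sum_le_of_block (i := q.1) (fun r => mul_nonneg (norm_nonneg _) (hp r).le)
      (fun r hr => by simp [hr]) (fun s => by simpa using hrow q.1 q.2 s) s)
    (fun r s => sum_le_of_block (i := r.1) (fun q => mul_nonneg (norm_nonneg _) (hp q).le)
      (fun q hq => by simp [hq.symm]) (fun s => by simpa using hcol r.1 r.2 s) s)
  refine ⟨T, fun x i j => ?_⟩
  simpa using (hasSum_mk_iff (i := i) fun q hq => by simp [hq]).1 (hT x (i, j))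

theorem inner_block_clm_basis {φ : HilbertBasis (κ × ℕ) ℂ H} {t : κ → ℕ → ℕ → ℂ}
    {T : H →L[ℂ] H}
    (hT : ∀ x i j, HasSum (fun n => t i j n * inner ℂ (φ (i, n)) x) (inner ℂ (φ (i, j)) (T x)))
    (i i' : κ) (j n : ℕ) :
    inner ℂ (φ (i, j)) (T (φ (i', n))) = if i = i' then t i j n else 0 := by
  refine (hT _ i j).unique ?_
  simp only [inner_basis_eq_ite, Prod.mk.injEq]
  by_cases hi : i = i'
  · simp only [hi, true_and, if_true]
    have := hasSum_ite_eq n (t i' j n)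
    refine this.congr_fun fun k => ?_
    by_cases hk : k = n
    · simp [hk]
    · simp [hk]
  · simp [hi, hasSum_zero]

theorem block_clm_comp_eq_id {φ : HilbertBasis (κ × ℕ) ℂ H} {s t : κ → ℕ → ℕ → ℂ}
    {S T : H →L[ℂ] H}
    (hS : ∀ x i j, HasSum (fun n => s i j n * inner ℂ (φ (i, n)) x) (inner ℂ (φ (i, j)) (S x)))
    (hT : ∀ x i j, HasSum (fun n => t i j n * inner ℂ (φ (i, n)) x) (inner ℂ (φ (i, j)) (T x)))
    (hst : ∀ i j k, HasSum (fun n => s i j n * t i n k) (if j = k then 1 else 0)) :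
    S.comp T = ContinuousLinearMap.id ℂ H := by
  refine clm_eq_of_forall_inner_eq φ fun q r => ?_
  refine (hS (T (φ r)) q.1 q.2).unique ?_
  have hr : ∀ n, inner ℂ (φ (q.1, n)) (T (φ r)) = if q.1 = r.1 then t q.1 n r.2 else 0 :=
    fun n => inner_block_clm_basis hT q.1 r.1 n r.2
  simp only [hr, ContinuousLinearMap.id_apply, inner_basis_eq_ite]
  by_cases hi : q.1 = r.1
  · simp only [hi, if_true, Prod.ext_iff, true_and]
    exact hst r.1 q.2 r.2
  · have : q ≠ r := fun h => hi (by rw [h])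
    simp [hi, this, hasSum_zero]

theorem summable_norm_inv_mul {R : ℝ} {f g : ℕ → ℂ} (hf : ∀ j, ‖(f j)⁻¹‖ ≤ R)
    (hg : Summable fun j => ‖(g j)⁻¹‖) : Summable fun j => ‖(f j * g j)⁻¹‖ := by
  refine Summable.of_nonneg_of_le (fun _ => norm_nonneg _) (fun j => ?_) (hg.mul_left R)
  rw [mul_inv, norm_mul]
  exact mul_le_mul_of_nonneg_right (hf j) (norm_nonneg _)

end MatrixOperator

/-! ### Eigenbasis coordinates of `D(A)` and `D(A)'`. -/

namespace DiagonalOperator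

variable {H : Type*} [NormedAddCommGroup H] [InnerProductSpace ℂ H] [CompleteSpace H] {m : ℕ}
  (A : DiagonalOperator H m)

theorem inner_adj_left (v w : A.op.domain) : inner ℂ (A.adj v) (w : H) = inner ℂ (v : H) (A.op w) :=
  LinearPMap.adjoint_isFormalAdjoint A.dense_domain ⟨v, A.mem_adjoint_domain v⟩ w

/-- The eigenvector `φ p` as an element of `D(A)`. -/
noncomputable def basisVec (p : Fin m × ℕ) : A.op.domain := ⟨A.φ p, A.mem_domain p⟩

theorem op_basisVec (p : Fin m × ℕ) : A.op (A.basisVec p) = A.ev p.1 p.2 • A.φ p :=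
  A.op_apply p.1 p.2

theorem inner_adj (p : Fin m × ℕ) (v : A.op.domain) :
    inner ℂ (A.φ p) (A.adj v) = starRingEnd ℂ (A.ev p.1 p.2) * inner ℂ (A.φ p) (v : H) := by
  have h := A.inner_adj_left v (A.basisVec p)
  rw [op_basisVec, inner_smul_right] at h
  rw [← inner_conj_symm, ← inner_conj_symm (A.φ p) (v : H), ← map_mul]
  exact congrArg _ h

theorem adj_basisVec (p : Fin m × ℕ) :
    A.adj (A.basisVec p) = starRingEnd ℂ (A.ev p.1 p.2) • A.φ p := by
  refine eq_of_forall_inner_eq A.φ fun q => ?_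
  rw [inner_adj, inner_smul_right]
  change _ * inner ℂ (A.φ q) (A.φ p) = _
  rw [inner_basis_eq_ite]
  split_ifs with h
  · rw [h]
  · simp

theorem inner_op (p : Fin m × ℕ) (f : A.op.domain) :
    inner ℂ (A.φ p) (A.op f) = A.ev p.1 p.2 * inner ℂ (A.φ p) (f : H) := by
  have h := A.inner_adj_left (A.basisVec p) f
  rw [adj_basisVec, inner_smul_left, Complex.conj_conj] at h
  exact h.symm

/-- The proof takes `ε = 1` in the self-adjoint case and `ε = -1` in the skew-adjoint one, so that
both can be treated together. -/
theorem conj_ev : ∃ ε : ℂ, ∀ i n, starRingEnd ℂ (A.ev i n) = ε * A.ev i n := by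
  have key : ∀ (B : H →ₗ.[ℂ] H) (_ : A.op.adjoint = B) (p) (hp : A.φ p ∈ B.domain),
      B ⟨A.φ p, hp⟩ = A.adj (A.basisVec p) := by
    rintro _ rfl p hp
    rfl
  have fin : ∀ (ε : ℂ) (p : Fin m × ℕ), (ε * A.ev p.1 p.2) • A.φ p = A.adj (A.basisVec p) →
      starRingEnd ℂ (A.ev p.1 p.2) = ε * A.ev p.1 p.2 := by
    intro ε p h
    rw [adj_basisVec] at h
    exact (smul_left_injective ℂ (A.φ.orthonormal.ne_zero p) h).symm
  rcases A.adjoint_eq with h | h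
  · refine ⟨1, fun i n => fin 1 (i, n) ?_⟩
    rw [← key _ h (i, n) (A.mem_domain _), one_mul]
    exact (A.op_basisVec (i, n)).symm
  · refine ⟨-1, fun i n => fin (-1) (i, n) ?_⟩
    rw [← key _ h (i, n) (A.mem_domain _), neg_mul, one_mul, neg_smul, LinearPMap.neg_apply]
    exact congrArg _ (A.op_basisVec (i, n)).symm

/-- Maximality of the diagonal operator: Parseval's formula puts `h` in the domain of the adjoint,
which is `D(A)`. -/
theorem mem_domain_of_inner {h w : H}
    (hw : ∀ p, inner ℂ (A.φ p) w = A.ev p.1 p.2 * inner ℂ (A.φ p) h) :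
    ∃ hh : h ∈ A.op.domain, A.op ⟨h, hh⟩ = w := by
  obtain ⟨ε, hε⟩ := A.conj_ev
  have hmem : h ∈ A.op.adjoint.domain := by
    refine LinearPMap.mem_adjoint_domain_of_exists h ⟨ε • w, fun v => ?_⟩
    refine (A.φ.hasSum_inner_mul_inner (ε • w) v).unique ?_
    convert! A.φ.hasSum_inner_mul_inner h (A.op v) using 1
    funext p
    rw [inner_op, ← inner_conj_symm, ← inner_conj_symm h, inner_smul_right, hw, ← mul_assoc, ← hε,
      map_mul, Complex.conj_conj]
    ring
  have hdom : h ∈ A.op.domain := by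
    rcases A.adjoint_eq with e | e
    · rwa [e] at hmem
    · rwa [e] at hmem
  exact ⟨hdom, eq_of_forall_inner_eq A.φ fun p => by rw [inner_op, hw]⟩

/-- `A` acts diagonally, so the eigenexpansion of `v` converges in the graph norm, for which `l` is
continuous. Identities in `D(A)'` may therefore be checked on the eigenvectors. -/
theorem hasSum_dual (l : A.Dual) (v : A.op.domain) :
    HasSum (fun p => starRingEnd ℂ (inner ℂ (A.φ p) (v : H)) * l.1 (A.basisVec p)) (l.1 v) := by
  obtain ⟨C, hC⟩ := l.2
  let S : Finset (Fin m × ℕ) → A.op.domain := fun s =>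
    ∑ p ∈ s, inner ℂ (A.φ p) (v : H) • A.basisVec p
  have h1 : Tendsto (fun s => ((S s : A.op.domain) : H)) atTop (𝓝 (v : H)) := by
    have e : (fun s => ((S s : A.op.domain) : H)) = fun s => ∑ p ∈ s, A.φ.repr v p • A.φ p := by
      funext s
      simp only [S, Submodule.coe_sum, Submodule.coe_smul, A.φ.repr_apply_apply]
      rfl
    rw [e]
    exact A.φ.hasSum_repr (v : H)
  have h2 : Tendsto (fun s => A.op (S s)) atTop (𝓝 (A.op v)) := by
    have e : (fun s => A.op (S s)) = fun s => ∑ p ∈ s, A.φ.repr (A.op v) p • A.φ p := by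
      funext s
      have hS : A.op (S s) = A.op.toFun (S s) := rfl
      rw [hS]
      simp only [S, map_sum, map_smul, A.φ.repr_apply_apply, inner_op]
      refine Finset.sum_congr rfl fun p _ => ?_
      have hp : A.op.toFun (A.basisVec p) = A.ev p.1 p.2 • A.φ p := A.op_basisVec p
      rw [hp, smul_smul, mul_comm]
    rw [e]
    exact A.φ.hasSum_repr (A.op v)
  have h3 : Tendsto (fun s => l.1 (S s)) atTop (𝓝 (l.1 v)) := by
    rw [tendsto_iff_norm_sub_tendsto_zero]
    have h4 : Tendsto (fun s => C * (‖((S s : A.op.domain) : H) - v‖ + ‖A.op (S s) - A.op v‖))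
        atTop (𝓝 0) := by
      have := ((tendsto_iff_norm_sub_tendsto_zero.1 h1).add
        (tendsto_iff_norm_sub_tendsto_zero.1 h2)).const_mul C
      simpa using this
    refine squeeze_zero (fun _ => norm_nonneg _) (fun s => ?_) h4
    rw [← map_sub, ← LinearPMap.map_sub]
    exact hC (S s - v)
  have e : (fun s => l.1 (S s)) = fun s =>
      ∑ p ∈ s, starRingEnd ℂ (inner ℂ (A.φ p) (v : H)) * l.1 (A.basisVec p) := by
    funext s
    simp [S, map_sum]
  rw [e] at h3
  exact h3

theorem dual_ext {l l' : A.Dual} (h : ∀ p, l.1 (A.basisVec p) = l'.1 (A.basisVec p)) : l = l' := by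
  refine Subtype.ext (LinearMap.ext fun v => (A.hasSum_dual l v).unique ?_)
  simpa only [h] using A.hasSum_dual l' v

@[simp] theorem pivot_basisVec (x : H) (p : Fin m × ℕ) :
    (A.pivot x).1 (A.basisVec p) = inner ℂ (A.φ p) x := rfl

@[simp] theorem extend_basisVec (x : H) (p : Fin m × ℕ) :
    (A.extend x).1 (A.basisVec p) = A.ev p.1 p.2 * inner ℂ (A.φ p) x := by
  change inner ℂ (A.adj (A.basisVec p)) x = _
  rw [adj_basisVec, inner_smul_left, Complex.conj_conj]

end DiagonalOperator

/-! ### Uniform estimates from the gap condition and non-resonance. -/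

section Kernel

/-- A summable convolution kernel that dominates the Cauchy matrices. -/
noncomputable def decayKernel (α : ℝ) (d : ℤ) : ℝ := (1 + |(d : ℝ)| ^ α)⁻¹

theorem decayKernel_nonneg (α : ℝ) (d : ℤ) : 0 ≤ decayKernel α d :=
  inv_nonneg.2 (add_nonneg zero_le_one (Real.rpow_nonneg (abs_nonneg _) _))

theorem decayKernel_neg (α : ℝ) (d : ℤ) : decayKernel α (-d) = decayKernel α d := by
  simp [decayKernel]

theorem summable_decayKernel {α : ℝ} (hα : 1 < α) : Summable (decayKernel α) := by
  have h1 := Real.summable_abs_int_rpow hα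
  have h2 : Summable fun d : ℤ => if d = 0 then (1 : ℝ) else 0 :=
    summable_of_ne_finset_zero (s := {0}) fun d hd => if_neg (by simpa using hd)
  refine Summable.of_nonneg_of_le (decayKernel_nonneg α) (fun d => ?_) (h1.add h2)
  rcases eq_or_ne d 0 with rfl | hd
  · simp [decayKernel, Real.zero_rpow (by linarith : α ≠ 0), Real.zero_rpow (by linarith : -α ≠ 0)]
  · have : 0 < |(d : ℝ)| := abs_pos.2 (by exact_mod_cast hd)
    rw [if_neg hd, add_zero, decayKernel, Real.rpow_neg this.le]
    have := Real.rpow_pos_of_pos this α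
    gcongr
    linarith

theorem exists_sum_decayKernel_le {α : ℝ} (hα : 1 < α) :
    ∃ G : ℝ, 0 ≤ G ∧ (∀ (n : ℕ) (s : Finset ℕ), ∑ k ∈ s, decayKernel α ((k : ℤ) - n) ≤ G) ∧
      ∀ (n : ℕ) (s : Finset ℕ), ∑ k ∈ s, decayKernel α ((n : ℤ) - k) ≤ G := by
  have h := summable_decayKernel hα
  have key : ∀ (n : ℕ) (s : Finset ℕ),
      ∑ k ∈ s, decayKernel α ((k : ℤ) - n) ≤ ∑' d, decayKernel α d := by
    intro n s
    rw [← Finset.sum_image (f := decayKernel α) (g := fun k : ℕ => (k : ℤ) - n)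
      fun a _ b _ hab => by simpa using hab]
    exact h.sum_le_tsum _ fun _ _ => decayKernel_nonneg α _
  refine ⟨_, tsum_nonneg (decayKernel_nonneg α), key, fun n s => ?_⟩
  refine le_trans (le_of_eq (Finset.sum_congr rfl fun k _ => ?_)) (key n s)
  rw [← decayKernel_neg, neg_sub]

theorem exists_pos_le_of_finset {ι : Type*} (s : Finset ι) {f : ι → ℝ} (hf : ∀ i ∈ s, 0 < f i) :
    ∃ δ : ℝ, 0 < δ ∧ ∀ i ∈ s, δ ≤ f i := by
  rcases s.eq_empty_or_nonempty with rfl | hs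
  · exact ⟨1, one_pos, by simp⟩
  · obtain ⟨i, hi, h⟩ := s.exists_min_image f hs
    exact ⟨f i, hf i hi, h⟩

end Kernel

namespace DiagonalOperator

variable {H : Type*} [NormedAddCommGroup H] [InnerProductSpace ℂ H] [CompleteSpace H] {m : ℕ}
  {A : DiagonalOperator H m} {U : Type*} [NormedAddCommGroup U] [NormedSpace ℂ U] {α : ℝ}
  {e : Module.Basis (Fin m) ℂ U} {B : U →ₗ[ℂ] A.Dual}

/-- By symmetry the larger index may carry the weight, and for `n ≤ k` one has `(k + 1) ^ (α - 1) ≥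
(k - n) ^ (α - 1)`. -/
theorem Framework.exists_gap_rpow (hyp : A.Framework α e B) :
    ∃ c : ℝ, 0 < c ∧ ∀ i (k n : ℕ), c * |(k : ℝ) - n| ^ α ≤ ‖A.ev i k - A.ev i n‖ := by
  obtain ⟨c, hc, h⟩ := hyp.gap
  have hα := hyp.one_lt
  have key : ∀ i (k n : ℕ), n ≤ k → c * |(k : ℝ) - n| ^ α ≤ ‖A.ev i k - A.ev i n‖ := by
    intro i k n hnk
    refine le_trans ?_ (h i k n)
    have h0 : (0 : ℝ) ≤ (k : ℝ) - n := sub_nonneg.2 (by exact_mod_cast hnk)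
    rw [abs_of_nonneg h0, mul_assoc]
    refine mul_le_mul_of_nonneg_left ?_ hc.le
    calc ((k : ℝ) - n) ^ α = ((k : ℝ) - n) ^ (α - 1) * ((k : ℝ) - n) := by
          rw [← Real.rpow_add_one' h0 (by linarith)]; ring_nf
      _ ≤ ((k : ℝ) + 1) ^ (α - 1) * ((k : ℝ) - n) := by
          refine mul_le_mul_of_nonneg_right (Real.rpow_le_rpow h0 ?_ (by linarith)) h0
          have : (0 : ℝ) ≤ n := n.cast_nonneg
          linarith
  refine ⟨c, hc, fun i k n => ?_⟩
  rcases le_total n k with hnk | hnk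
  · exact key i k n hnk
  · rw [abs_sub_comm, norm_sub_rev]
    exact key i n k hnk

/-- Differences of distinct eigenvalues of a block exceed `2 * μ` in modulus as soon as one index is
large. Only finitely many pairs remain, and non-resonance handles them. -/
theorem Framework.exists_dist_shift (hyp : A.Framework α e B) {μ : ℝ} (hμ : 0 < μ)
    (hr : A.NonResonant μ) :
    ∃ δ : ℝ, 0 < δ ∧ ∀ i k n, δ ≤ ‖A.ev i k - A.ev i n - μ‖ := by
  obtain ⟨c, hc, h⟩ := hyp.gap
  have hα := hyp.one_lt
  have ht : Tendsto (fun N : ℕ => c * ((N : ℝ) + 1) ^ (α - 1)) atTop atTop :=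
    ((tendsto_rpow_atTop (by linarith)).comp
      (tendsto_atTop_add_const_right _ _ tendsto_natCast_atTop_atTop)).const_mul_atTop hc
  obtain ⟨N, hN⟩ := eventually_atTop.1 (ht.eventually_ge_atTop (2 * μ))
  have hnμ : ‖(μ : ℂ)‖ = μ := by rw [Complex.norm_real, Real.norm_of_nonneg hμ.le]
  have key : ∀ i (k n : ℕ), k ≠ n → N ≤ k → 2 * μ ≤ ‖A.ev i k - A.ev i n‖ := by
    intro i k n hkn hk
    refine (hN k hk).trans (le_trans ?_ (h i k n))
    refine le_mul_of_one_le_right (by positivity) ?_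
    have : (k : ℤ) - n ≠ 0 := sub_ne_zero.2 (by exact_mod_cast hkn)
    have := Int.one_le_abs this
    exact_mod_cast this
  have far : ∀ i (k n : ℕ), 2 * μ ≤ ‖A.ev i k - A.ev i n‖ →
      μ ≤ ‖A.ev i k - A.ev i n - μ‖ := by
    intro i k n hkn
    have := norm_sub_norm_le (A.ev i k - A.ev i n) (μ : ℂ)
    linarith
  obtain ⟨δ, hδ, hle⟩ := exists_pos_le_of_finset
    ((Finset.univ : Finset (Fin m)) ×ˢ Finset.range N ×ˢ Finset.range N)
    (f := fun q => ‖A.ev q.1 q.2.1 - A.ev q.1 q.2.2 - μ‖)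
    fun q _ => norm_pos_iff.2 (sub_ne_zero.2 (hr q.1 q.2.1 q.2.2).symm)
  refine ⟨min δ μ, lt_min hδ hμ, fun i k n => ?_⟩
  rcases eq_or_ne k n with rfl | hkn
  · rw [sub_self, zero_sub, norm_neg, hnμ]
    exact min_le_right _ _
  rcases le_or_gt N k with hk | hk
  · exact (min_le_right _ _).trans (far i k n (key i k n hkn hk))
  rcases le_or_gt N n with hn | hn
  · refine (min_le_right _ _).trans (far i k n ?_)
    rw [norm_sub_rev]
    exact key i n k hkn.symm hn
  · exact (min_le_left _ _).trans (hle (i, k, n) (by simp [hk, hn]))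

/-- Uniform bounds, with a common constant `R`, on the data of the problem for the shift `μ`. -/
structure Estimates (e : Module.Basis (Fin m) ℂ U) (B : U →ₗ[ℂ] A.Dual) (μ R : ℝ) : Prop where
  nonneg : 0 ≤ R
  injective : ∀ i, Function.Injective (A.ev i)
  nonResonant : ∀ i k n, (μ : ℂ) ≠ A.ev i k - A.ev i n
  block : ∀ i j n, i ≠ j → (B (e i)).1 (A.basisVec (j, n)) = 0
  coeff_ne : ∀ i n, A.coeff e B i n ≠ 0
  norm_coeff_le : ∀ i n, ‖A.coeff e B i n‖ ≤ R
  norm_coeff_inv_le : ∀ i n, ‖(A.coeff e B i n)⁻¹‖ ≤ R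
  sum_inv_le : ∀ i j, ∀ s : Finset ℕ, ∑ k ∈ s, ‖(A.ev i j - A.ev i k)⁻¹‖ ≤ R
  sum_shift_left_le : ∀ i n, ∀ s : Finset ℕ, ∑ k ∈ s, ‖(A.ev i k - A.ev i n - μ)⁻¹‖ ≤ R
  sum_shift_right_le : ∀ i j, ∀ s : Finset ℕ, ∑ k ∈ s, ‖(A.ev i j - A.ev i k - μ)⁻¹‖ ≤ R
  norm_ev_sub_le : ∀ i k n, ‖A.ev i k - A.ev i n‖ ≤ R * ‖A.ev i k - A.ev i n - μ‖

theorem Framework.exists_estimates (hyp : A.Framework α e B) {μ : ℝ} (hμ : 0 < μ)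
    (hr : A.NonResonant μ) : ∃ R : ℝ, A.Estimates e B μ R := by
  obtain ⟨c, hc, hgap⟩ := hyp.exists_gap_rpow
  obtain ⟨δ, hδ, hdist⟩ := hyp.exists_dist_shift hμ hr
  obtain ⟨b, b', hb, hctrl⟩ := hyp.control
  obtain ⟨G, hG0, hG1, hG2⟩ := exists_sum_decayKernel_le hyp.one_lt
  have hnμ : ‖(μ : ℂ)‖ = μ := by rw [Complex.norm_real, Real.norm_of_nonneg hμ.le]
  have hsub : ∀ i k n, ‖A.ev i k - A.ev i n‖ ≤ (1 + μ / δ) * ‖A.ev i k - A.ev i n - μ‖ := by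
    intro i k n
    have h1 := norm_sub_norm_le (A.ev i k - A.ev i n) (μ : ℂ)
    have h2 : μ ≤ μ / δ * ‖A.ev i k - A.ev i n - μ‖ := by
      rw [div_mul_eq_mul_div, le_div_iff₀ hδ]
      exact mul_le_mul_of_nonneg_left (hdist i k n) hμ.le
    linarith
  have hone : ∀ i (k n : ℕ), k ≠ n → c ≤ ‖A.ev i k - A.ev i n‖ := by
    intro i k n hkn
    refine le_trans ?_ (hgap i k n)
    refine le_mul_of_one_le_right hc.le (Real.one_le_rpow ?_ (by linarith [hyp.one_lt]))
    have : (k : ℤ) - n ≠ 0 := sub_ne_zero.2 (by exact_mod_cast hkn)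
    have := Int.one_le_abs this
    exact_mod_cast this
  have hker : ∀ i (j k : ℕ), ‖(A.ev i j - A.ev i k)⁻¹‖ ≤ 2 / c * decayKernel α ((j : ℤ) - k) := by
    intro i j k
    -- On the diagonal `0⁻¹ = 0`, so the excluded term contributes nothing.
    rcases eq_or_ne j k with rfl | hjk
    · rw [sub_self, inv_zero, norm_zero]
      exact mul_nonneg (by positivity) (decayKernel_nonneg _ _)
    · have h1 := hgap i j k
      have h2 := hone i j k hjk
      have h3 : 0 < 1 + |(j : ℝ) - k| ^ α := by positivity
      rw [decayKernel, norm_inv]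
      push_cast
      rw [← div_eq_mul_inv, div_div, inv_eq_one_div, div_le_div_iff₀ (by linarith) (by positivity)]
      linarith
  -- The first summand comes from bounding `|j - k| ^ α` by the shifted difference, the second from
  -- bounding `1` by it.
  let D := (1 + μ / δ) / c + 1 / δ
  have hD : 0 ≤ D := by positivity
  have hshift : ∀ i (j k : ℕ),
      ‖(A.ev i j - A.ev i k - μ)⁻¹‖ ≤ D * decayKernel α ((j : ℤ) - k) := by
    intro i j k
    have h1 := (hgap i j k).trans (hsub i j k)
    have h2 := hdist i j k
    have h3 : 0 < 1 + |(j : ℝ) - k| ^ α := by positivity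
    rw [decayKernel, norm_inv]
    push_cast
    rw [← div_eq_mul_inv, inv_eq_one_div, div_le_div_iff₀ (by linarith) h3]
    have h4 : |(j : ℝ) - k| ^ α ≤ (1 + μ / δ) / c * ‖A.ev i j - A.ev i k - μ‖ := by
      rw [div_mul_eq_mul_div, le_div_iff₀ hc]
      linarith
    have h5 : 1 ≤ 1 / δ * ‖A.ev i j - A.ev i k - μ‖ := by
      rw [div_mul_eq_mul_div, le_div_iff₀ hδ]
      linarith
    calc 1 * (1 + |(j : ℝ) - k| ^ α) ≤ (1 + μ / δ) / c * ‖A.ev i j - A.ev i k - μ‖ +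
          1 / δ * ‖A.ev i j - A.ev i k - μ‖ := by linarith
      _ = D * ‖A.ev i j - A.ev i k - μ‖ := by rw [← add_mul]
  have hne : ∀ i n, 0 < ‖A.coeff e B i n‖ := fun i n => hb.trans_le (hctrl i n).1
  have hR : 0 ≤ |b'| + b⁻¹ + 2 / c * G + D * G + (1 + μ / δ) := by positivity
  refine ⟨|b'| + b⁻¹ + 2 / c * G + D * G + (1 + μ / δ), hR, A.ev_injective, hr, hyp.block,
    fun i n => norm_pos_iff.1 (hne i n), fun i n => ?_, fun i n => ?_, fun i j s => ?_,
    fun i n s => ?_, fun i j s => ?_, fun i k n => (hsub i k n).trans ?_⟩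
  · refine ((hctrl i n).2.trans (le_abs_self b')).trans ?_
    have : 0 ≤ b⁻¹ + 2 / c * G + D * G + (1 + μ / δ) := by positivity
    linarith
  · rw [norm_inv]
    refine (inv_anti₀ hb (hctrl i n).1).trans ?_
    have : 0 ≤ |b'| + 2 / c * G + D * G + (1 + μ / δ) := by positivity
    linarith
  · refine (Finset.sum_le_sum fun k _ => hker i j k).trans ?_
    rw [← Finset.mul_sum]
    refine (mul_le_mul_of_nonneg_left (hG2 j s) (by positivity)).trans ?_
    have : 0 ≤ |b'| + b⁻¹ + D * G + (1 + μ / δ) := by positivity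
    linarith
  · refine (Finset.sum_le_sum fun k _ => hshift i k n).trans ?_
    rw [← Finset.mul_sum]
    refine (mul_le_mul_of_nonneg_left (hG1 n s) hD).trans ?_
    have : 0 ≤ |b'| + b⁻¹ + 2 / c * G + (1 + μ / δ) := by positivity
    linarith
  · refine (Finset.sum_le_sum fun k _ => hshift i j k).trans ?_
    rw [← Finset.mul_sum]
    refine (mul_le_mul_of_nonneg_left (hG2 j s) hD).trans ?_
    have : 0 ≤ |b'| + b⁻¹ + 2 / c * G + (1 + μ / δ) := by positivity
    linarith
  · refine mul_le_mul_of_nonneg_right ?_ (norm_nonneg _)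
    have : 0 ≤ |b'| + b⁻¹ + 2 / c * G + D * G := by positivity
    linarith

end DiagonalOperator

/-! ### The feedback gains, the transform and its inverse. -/

namespace DiagonalOperator

variable {H : Type*} [NormedAddCommGroup H] [InnerProductSpace ℂ H] [CompleteSpace H] {m : ℕ}
  {A : DiagonalOperator H m} {U : Type*} [NormedAddCommGroup U] [NormedSpace ℂ U] {α : ℝ}
  {e : Module.Basis (Fin m) ℂ U} {B : U →ₗ[ℂ] A.Dual} {μ R : ℝ}

/-- The factor with `k = n` equals `1` because `μ / 0 = 0`. Hence products over `{k // k ≠ n}` agree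
with products over all of `ℕ`. -/
theorem mulSupport_shift_subset (l : ℕ → ℂ) (μ : ℂ) (n : ℕ) :
    Function.mulSupport (fun k => 1 - μ / (l n - l k)) ⊆ {k | k ≠ n} := by
  intro k hk hkn
  exact hk (by simp [hkn])

theorem prodMinus_eq (A : DiagonalOperator H m) (μ : ℝ) (i : Fin m) (n : ℕ) :
    A.prodMinus μ i n = shiftProd (A.ev i) μ n :=
  tprod_subtype_eq_of_mulSupport_subset (mulSupport_shift_subset (A.ev i) μ n)

theorem prodPlus_eq (A : DiagonalOperator H m) (μ : ℝ) (i : Fin m) (n : ℕ) :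
    A.prodPlus μ i n = shiftProd (A.ev i) (-μ) n := by
  have h := tprod_subtype_eq_of_mulSupport_subset (mulSupport_shift_subset (A.ev i) (-μ) n)
  simp only [neg_div, sub_neg_eq_add] at h
  rw [prodPlus, shiftProd]
  simp only [neg_div, sub_neg_eq_add]
  exact h

namespace Estimates

theorem neg_nonResonant (h : A.Estimates e B μ R)
    (i : Fin m) (k n : ℕ) : (-μ : ℂ) ≠ A.ev i k - A.ev i n := fun hk =>
  h.nonResonant i n k (by rw [← neg_sub, ← hk, neg_neg])

theorem shift_ne (h : A.Estimates e B μ R) (i : Fin m) (k n : ℕ) : A.ev i k - A.ev i n - μ ≠ 0 :=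
  sub_ne_zero.2 (h.nonResonant i k n).symm

theorem summable_shift_left (h : A.Estimates e B μ R) (i : Fin m) (n : ℕ) :
    Summable fun k => ‖(A.ev i k - A.ev i n - μ)⁻¹‖ :=
  summable_of_sum_le (fun _ => norm_nonneg _) (h.sum_shift_left_le i n)

theorem summable_shift_right (h : A.Estimates e B μ R) (i : Fin m) (j : ℕ) :
    Summable fun k => ‖(A.ev i j - A.ev i k - μ)⁻¹‖ :=
  summable_of_sum_le (fun _ => norm_nonneg _) (h.sum_shift_right_le i j)

theorem norm_shift_inv_le (h : A.Estimates e B μ R)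
    (i : Fin m) (k n : ℕ) : ‖(A.ev i k - A.ev i n - μ)⁻¹‖ ≤ R := by
  simpa using h.sum_shift_left_le i n {k}

theorem hasSum_prodMinus (h : A.Estimates e B μ R) (i : Fin m) (n : ℕ) :
    HasSum (fun j => μ * shiftProd (A.ev i) μ j / (A.ev i n + μ - A.ev i j)) 1 := by
  refine hasSum_shiftProd_div (h.injective i) (h.sum_inv_le i) (h.nonResonant i) n ?_
  refine (h.summable_shift_left i n).congr fun j => ?_
  rw [norm_inv, norm_inv, ← norm_neg]
  congr 2
  ring

/-- The scalar form of `T B = B`, obtained from the expansion for the shift `-μ`. -/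
theorem hasSum_prodPlus (h : A.Estimates e B μ R) (i : Fin m) (j : ℕ) :
    HasSum (fun n => -μ * shiftProd (A.ev i) (-μ) n / (A.ev i j - A.ev i n - μ)) 1 := by
  have hs := hasSum_shiftProd_div (h.injective i) (h.sum_inv_le i) (h.neg_nonResonant i) j ?_
  · refine hs.congr_fun ?_
    intro n
    congr 1
    ring
  · refine (h.summable_shift_right i j).congr fun n => ?_
    congr 2
    ring

/-- The factor depending only on `n` comes out, and the remaining series is `hasSum_prodMinus`. This
closed form of the row sums is what shows that the gains are bounded. -/
theorem hasSum_cauchyInv (h : A.Estimates e B μ R) (i : Fin m) (n : ℕ) :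
    HasSum (fun j => A.cauchyInv μ i n j) (-μ * shiftProd (A.ev i) (-μ) n) := by
  have hs := (h.hasSum_prodMinus i n).mul_left (-μ * shiftProd (A.ev i) (-μ) n)
  rw [mul_one] at hs
  refine hs.congr_fun fun j => ?_
  have h1 := h.shift_ne i j n
  have h2 : A.ev i n + μ - A.ev i j ≠ 0 := by
    rw [← neg_ne_zero]
    convert! h1 using 1
    ring
  rw [cauchyInv, prodPlus_eq, prodMinus_eq]
  field_simp
  ring

theorem gainConverges (h : A.Estimates e B μ R) : A.GainConverges μ := by
  intro i n
  refine ⟨?_, ?_, (h.hasSum_cauchyInv i n).summable⟩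
  · have := ((hasProd_subtype_iff_of_mulSupport_subset
      (mulSupport_shift_subset (A.ev i) (-μ) n)).2
      (multipliable_shift (h.sum_inv_le i) (-μ) n).hasProd).multipliable
    simp only [Function.comp_def, neg_div, sub_neg_eq_add] at this
    exact this
  · exact ((hasProd_subtype_iff_of_mulSupport_subset
      (mulSupport_shift_subset (A.ev i) μ n)).2
      (multipliable_shift (h.sum_inv_le i) μ n).hasProd).multipliable

theorem gain_eq (h : A.Estimates e B μ R) (i : Fin m) (n : ℕ) :
    A.gain e B μ i n = -μ * shiftProd (A.ev i) (-μ) n / A.coeff e B i n := by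
  rw [gain, (h.hasSum_cauchyInv i n).tsum_eq]

theorem exists_norm_gain_le (h : A.Estimates e B μ R)
    : ∃ C : ℝ, 0 ≤ C ∧ ∀ i n, ‖A.gain e B μ i n‖ ≤ C := by
  have hR := h.nonneg
  refine ⟨‖(-μ : ℂ)‖ * Real.exp (‖(-μ : ℂ)‖ * R) * R, by positivity, fun i n => ?_⟩
  rw [h.gain_eq, div_eq_mul_inv, norm_mul, norm_mul]
  gcongr
  · exact norm_shiftProd_le (h.sum_inv_le i) _ n
  · exact h.norm_coeff_inv_le i n

end Estimates

/-- The matrix of the transform in the eigenbasis of `H_i`. -/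
noncomputable def transEntry (e : Module.Basis (Fin m) ℂ U) (B : U →ₗ[ℂ] A.Dual) (μ : ℝ)
    (i : Fin m) (j n : ℕ) : ℂ :=
  A.gain e B μ i n * (A.coeff e B i j / (A.ev i j - A.ev i n - μ))

/-- The coefficients of the feedback that undoes the shift. -/
noncomputable def invGain (e : Module.Basis (Fin m) ℂ U) (B : U →ₗ[ℂ] A.Dual) (μ : ℝ)
    (i : Fin m) (j : ℕ) : ℂ :=
  -μ * shiftProd (A.ev i) μ j / A.coeff e B i j

/-- The matrix of the inverse transform in the eigenbasis of `H_i`. -/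
noncomputable def invTransEntry (e : Module.Basis (Fin m) ℂ U) (B : U →ₗ[ℂ] A.Dual) (μ : ℝ)
    (i : Fin m) (n j : ℕ) : ℂ :=
  invGain e B μ i j * (A.coeff e B i n / (A.ev i j - A.ev i n - μ))

namespace Estimates

theorem exists_norm_invGain_le (h : A.Estimates e B μ R)
    : ∃ C : ℝ, 0 ≤ C ∧ ∀ i n, ‖invGain e B μ i n‖ ≤ C := by
  have hR := h.nonneg
  refine ⟨‖(-μ : ℂ)‖ * Real.exp (‖(μ : ℂ)‖ * R) * R, by positivity, fun i n => ?_⟩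
  rw [invGain, div_eq_mul_inv, norm_mul, norm_mul]
  gcongr
  · exact norm_shiftProd_le (h.sum_inv_le i) _ n
  · exact h.norm_coeff_inv_le i n

theorem hasSum_transEntry_coeff (h : A.Estimates e B μ R) (i : Fin m) (j : ℕ) :
    HasSum (fun n => transEntry e B μ i j n * A.coeff e B i n) (A.coeff e B i j) := by
  have hs := (h.hasSum_prodPlus i j).mul_left (A.coeff e B i j)
  rw [mul_one] at hs
  refine hs.congr_fun fun n => ?_
  have h1 := h.coeff_ne i n
  rw [transEntry, h.gain_eq]
  field_simp

theorem hasSum_invTransEntry_mul_transEntry (h : A.Estimates e B μ R) (i : Fin m) (n k : ℕ) :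
    HasSum (fun j => invTransEntry e B μ i n j * transEntry e B μ i j k)
      (if n = k then 1 else 0) := by
  have hs := (hasSum_cauchy_orthogonal (h.injective i) (h.sum_inv_le i) (h.nonResonant i) k n
    (summable_norm_inv_mul (fun j => h.norm_shift_inv_le i j k)
      (h.summable_shift_left i n))).mul_left (A.coeff e B i n / A.coeff e B i k)
  convert! hs using 1
  · funext j
    have h1 := h.coeff_ne i j
    have h2 := h.coeff_ne i k
    have h3 := h.shift_ne i j n
    have h4 := h.shift_ne i j k
    rw [transEntry, invTransEntry, h.gain_eq, invGain]
    field_simp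
  · rcases eq_or_ne n k with rfl | hnk
    · simp [h.coeff_ne i n]
    · simp [hnk, hnk.symm]

/-- Replacing `μ` by `-μ` exchanges rows and columns of the Cauchy matrix, so the same orthogonality
relation gives the inverse on the other side. -/
theorem hasSum_transEntry_mul_invTransEntry (h : A.Estimates e B μ R) (i : Fin m) (j k : ℕ) :
    HasSum (fun n => transEntry e B μ i j n * invTransEntry e B μ i n k)
      (if j = k then 1 else 0) := by
  have hneg : ∀ a n : ℕ, A.ev i n - A.ev i a - -μ = -(A.ev i a - A.ev i n - μ) := fun a n => by
    ring
  have hsum : Summable fun n =>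
      ‖((A.ev i n - A.ev i k - -μ) * (A.ev i n - A.ev i j - -μ))⁻¹‖ := by
    simp only [hneg, neg_mul_neg]
    exact summable_norm_inv_mul (fun n => h.norm_shift_inv_le i k n)
      (h.summable_shift_right i j)
  have hs := (hasSum_cauchy_orthogonal (h.injective i) (h.sum_inv_le i) (h.neg_nonResonant i)
    k j hsum).mul_left (A.coeff e B i j / A.coeff e B i k)
  convert! hs using 1
  · funext n
    have h1 := h.coeff_ne i n
    have h2 := h.coeff_ne i k
    have h3 := h.shift_ne i j n
    have h4 := h.shift_ne i k n
    rw [hneg, hneg, neg_mul_neg, neg_neg, transEntry, invTransEntry, h.gain_eq, invGain]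
    field_simp
  · rcases eq_or_ne j k with rfl | hjk
    · simp [h.coeff_ne i j]
    · simp [hjk, hjk.symm]

theorem norm_transEntry_le (h : A.Estimates e B μ R)
    {C : ℝ} (hC : ∀ i n, ‖A.gain e B μ i n‖ ≤ C) (i : Fin m) (j n : ℕ) :
    ‖transEntry e B μ i j n‖ ≤ C * R * ‖(A.ev i j - A.ev i n - μ)⁻¹‖ := by
  have hC0 : 0 ≤ C := (norm_nonneg _).trans (hC i n)
  rw [transEntry, div_eq_mul_inv, norm_mul, norm_mul, ← mul_assoc]
  gcongr
  · exact hC i n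
  · exact h.norm_coeff_le i j

theorem norm_invTransEntry_le (h : A.Estimates e B μ R)
    {C : ℝ} (hC : ∀ i n, ‖invGain e B μ i n‖ ≤ C) (i : Fin m)
    (n j : ℕ) : ‖invTransEntry e B μ i n j‖ ≤ C * R * ‖(A.ev i j - A.ev i n - μ)⁻¹‖ := by
  have hC0 : 0 ≤ C := (norm_nonneg _).trans (hC i j)
  rw [invTransEntry, div_eq_mul_inv, norm_mul, norm_mul, ← mul_assoc]
  gcongr
  · exact hC i j
  · exact h.norm_coeff_le i n

theorem exists_sum_norm_transEntry_le (h : A.Estimates e B μ R) : ∃ D : ℝ, 0 ≤ D ∧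
    (∀ i j, ∀ s : Finset ℕ, ∑ n ∈ s, ‖transEntry e B μ i j n‖ ≤ D) ∧
    ∀ i n, ∀ s : Finset ℕ, ∑ j ∈ s, ‖transEntry e B μ i j n‖ ≤ D := by
  obtain ⟨C, hC0, hC⟩ := h.exists_norm_gain_le
  have hR := h.nonneg
  refine ⟨C * R * R, by positivity, fun i j s => ?_, fun i n s => ?_⟩
  · refine (Finset.sum_le_sum fun n _ => h.norm_transEntry_le hC i j n).trans ?_
    rw [← Finset.mul_sum]
    exact mul_le_mul_of_nonneg_left (h.sum_shift_right_le i j s) (by positivity)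
  · refine (Finset.sum_le_sum fun j _ => h.norm_transEntry_le hC i j n).trans ?_
    rw [← Finset.mul_sum]
    exact mul_le_mul_of_nonneg_left (h.sum_shift_left_le i n s) (by positivity)

/-- The transform is an isomorphism of `H`, and its inverse is given by `invTransEntry`. -/
theorem exists_transform (h : A.Estimates e B μ R) : ∃ T : H ≃L[ℂ] H,
    (∀ x i j, HasSum (fun n => transEntry e B μ i j n * inner ℂ (A.φ (i, n)) x)
      (inner ℂ (A.φ (i, j)) (T x))) ∧
    ∀ x i n, HasSum (fun j => invTransEntry e B μ i n j * inner ℂ (A.φ (i, j)) x)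
      (inner ℂ (A.φ (i, n)) (T.symm x)) := by
  have hR := h.nonneg
  obtain ⟨D, hD0, hD1, hD2⟩ := h.exists_sum_norm_transEntry_le
  -- Rows and columns are uniformly summable, so constant Schur weights suffice.
  obtain ⟨T, hT⟩ := exists_block_clm A.φ (t := transEntry e B μ) (p := fun _ => 1) (R := D)
    (fun _ => one_pos) (fun i j s => by simpa using hD1 i j s)
    (fun i n s => by simpa using hD2 i n s)
  obtain ⟨C', hC'0, hC'⟩ := h.exists_norm_invGain_le
  obtain ⟨S, hS⟩ := exists_block_clm A.φ (t := invTransEntry e B μ) (p := fun _ => 1)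
    (R := C' * R * R) (fun _ => one_pos)
    (fun i n s => by
      simp only [mul_one]
      refine (Finset.sum_le_sum fun j _ => h.norm_invTransEntry_le hC' i n j).trans ?_
      rw [← Finset.mul_sum]
      exact mul_le_mul_of_nonneg_left (h.sum_shift_left_le i n s) (by positivity))
    (fun i j s => by
      simp only [mul_one]
      refine (Finset.sum_le_sum fun n _ => h.norm_invTransEntry_le hC' i n j).trans ?_
      rw [← Finset.mul_sum]
      exact mul_le_mul_of_nonneg_left (h.sum_shift_right_le i j s) (by positivity))
  have h1 := block_clm_comp_eq_id hS hT h.hasSum_invTransEntry_mul_transEntry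
  have h2 := block_clm_comp_eq_id hT hS h.hasSum_transEntry_mul_invTransEntry
  exact ⟨ContinuousLinearEquiv.equivOfInverse T S (fun x => DFunLike.congr_fun h1 x)
    (fun x => DFunLike.congr_fun h2 x), hT, hS⟩

theorem isTransform_of_hasSum {T : H →L[ℂ] H}
    (hT : ∀ x i j, HasSum (fun n => transEntry e B μ i j n * inner ℂ (A.φ (i, n)) x)
      (inner ℂ (A.φ (i, j)) (T x))) : A.IsTransform e B μ T := by
  intro i n
  have hs := A.φ.hasSum_repr (T (A.φ (i, n)))
  have hr : ∀ q, A.φ.repr (T (A.φ (i, n))) q = if q.1 = i then transEntry e B μ q.1 q.2 n else 0 :=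
    fun q => by rw [A.φ.repr_apply_apply]; exact inner_block_clm_basis hT q.1 i q.2 n
  simp only [hr] at hs
  have := (hasSum_mk_iff (i := i) fun q hq => by simp [hq]).1 hs
  simpa only [if_true, transEntry] using this

end Estimates

end DiagonalOperator

/-! ### The feedback, the intertwining relation and the domain of the closed loop. -/

namespace DiagonalOperator

variable {H : Type*} [NormedAddCommGroup H] [InnerProductSpace ℂ H] [CompleteSpace H] {m : ℕ}
  {A : DiagonalOperator H m} {U : Type*} [NormedAddCommGroup U] [NormedSpace ℂ U] {α : ℝ}
  {e : Module.Basis (Fin m) ℂ U} {B : U →ₗ[ℂ] A.Dual} {μ R : ℝ}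

theorem weight_pos (A : DiagonalOperator H m) (s : ℝ) (p : Fin m × ℕ) : 0 < A.weight s p :=
  Real.rpow_pos_of_pos (by positivity) _

theorem Framework.exists_ev_growth (hyp : A.Framework α e B) :
    ∃ c : ℝ, 0 < c ∧ ∀ i (n : ℕ), c * ((n : ℝ) + 1) ^ (2 * α) ≤ 1 + ‖A.ev i n‖ ^ 2 := by
  obtain ⟨c, hc, hgap⟩ := hyp.exists_gap_rpow
  have hα := hyp.one_lt
  -- Growth is measured from the first eigenvalue of each block; `L` bounds all of these at once.
  let L : ℝ := ∑ i, ‖A.ev i 0‖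
  have hL : ∀ i, ‖A.ev i 0‖ ≤ L := fun i =>
    Finset.single_le_sum (f := fun i => ‖A.ev i 0‖) (fun _ _ => norm_nonneg _) (Finset.mem_univ i)
  have hL0 : 0 ≤ L := Finset.sum_nonneg fun _ _ => norm_nonneg _
  have hpow : (0 : ℝ) < 2 ^ α := by positivity
  have key : ∀ i (n : ℕ), c * ((n : ℝ) + 1) ^ α ≤ 2 ^ α * (c + 1 + L) * (1 + ‖A.ev i n‖) := by
    intro i n
    have h1 : c * (n : ℝ) ^ α ≤ ‖A.ev i n‖ + L := by
      have h := hgap i n 0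
      rw [Nat.cast_zero, sub_zero, Nat.abs_cast] at h
      exact h.trans ((norm_sub_le _ _).trans (by linarith [hL i]))
    have h2 : ((n : ℝ) + 1) ^ α ≤ 2 ^ α * (1 + (n : ℝ) ^ α) := by
      rcases Nat.eq_zero_or_pos n with rfl | hn
      · have : (1 : ℝ) ≤ 2 ^ α := Real.one_le_rpow (by norm_num) (by linarith)
        simp only [Nat.cast_zero, zero_add, Real.one_rpow]
        rw [Real.zero_rpow (by linarith)]
        linarith
      · have hn' : (1 : ℝ) ≤ n := by exact_mod_cast hn
        calc ((n : ℝ) + 1) ^ α ≤ (2 * (n : ℝ)) ^ α :=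
              Real.rpow_le_rpow (by positivity) (by linarith) (by linarith)
          _ = 2 ^ α * (n : ℝ) ^ α := Real.mul_rpow (by norm_num) (by positivity)
          _ ≤ 2 ^ α * (1 + (n : ℝ) ^ α) := by gcongr; linarith
    calc c * ((n : ℝ) + 1) ^ α ≤ c * (2 ^ α * (1 + (n : ℝ) ^ α)) := by gcongr
      _ = 2 ^ α * (c + c * (n : ℝ) ^ α) := by ring
      _ ≤ 2 ^ α * ((c + 1 + L) * (1 + ‖A.ev i n‖)) := by
          gcongr
          have := norm_nonneg (A.ev i n)
          nlinarith [mul_nonneg hL0 this, mul_nonneg hc.le this]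
      _ = _ := by ring
  let E : ℝ := 2 ^ α * (c + 1 + L)
  have hE : 0 < E := by positivity
  refine ⟨c ^ 2 / (2 * E ^ 2), by positivity, fun i n => ?_⟩
  have h1 : (c * ((n : ℝ) + 1) ^ α) ^ 2 ≤ (E * (1 + ‖A.ev i n‖)) ^ 2 :=
    pow_le_pow_left₀ (by positivity) (key i n) 2
  have h2 : ((n : ℝ) + 1) ^ (2 * α) = (((n : ℝ) + 1) ^ α) ^ 2 := by
    rw [mul_comm, Real.rpow_mul (by positivity)]
    norm_num
  rw [h2, div_mul_eq_mul_div, div_le_iff₀ (by positivity), ← mul_pow]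
  refine h1.trans ?_
  rw [mul_pow]
  have h3 : (1 + ‖A.ev i n‖) ^ 2 ≤ 2 * (1 + ‖A.ev i n‖ ^ 2) := by
    nlinarith [sq_nonneg (1 - ‖A.ev i n‖)]
  nlinarith [mul_le_mul_of_nonneg_left h3 (sq_nonneg E)]

/-- The weight grows at least like `(n + 1) ^ (2 * α * s)`, and the threshold `1 / (2 * α)` is what
makes this exponent exceed `1`. -/
theorem Framework.summable_inv_weight (hyp : A.Framework α e B) {s : ℝ} (hs : 1 / (2 * α) < s) :
    Summable fun p => (A.weight s p)⁻¹ := by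
  obtain ⟨c, hc, hgrow⟩ := hyp.exists_ev_growth
  have hα := hyp.one_lt
  have h1 : 1 < 2 * α * s := by
    rw [div_lt_iff₀ (by linarith)] at hs
    linarith
  have hs0 : 0 < s := lt_trans (by positivity) hs
  have hsum : Summable fun n : ℕ => (c ^ s)⁻¹ * (((n : ℝ) + 1) ^ (2 * α * s))⁻¹ := by
    refine Summable.mul_left _ ?_
    have := (summable_nat_add_iff 1).2 (Real.summable_nat_rpow_inv.2 h1)
    simpa using this
  refine (summable_prod_of_nonneg fun p => inv_nonneg.2 (A.weight_nonneg s p)).2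
    ⟨fun i => ?_, Summable.of_finite⟩
  refine Summable.of_nonneg_of_le (fun n => inv_nonneg.2 (A.weight_nonneg s _)) (fun n => ?_) hsum
  rw [← mul_inv, Real.rpow_mul (by positivity), ← Real.mul_rpow hc.le (by positivity)]
  refine inv_anti₀ (by positivity) ?_
  exact Real.rpow_le_rpow (by positivity) (hgrow i n) hs0.le

/-- Cauchy–Schwarz against the summable inverse weights. Vectors of `D(A^s)` thus have absolutely
summable coordinates, on which bounded gains define a feedback. -/
theorem Framework.exists_sum_norm_inner_le (hyp : A.Framework α e B) {s : ℝ}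
    (hs : 1 / (2 * α) < s) : ∃ C : ℝ, 0 ≤ C ∧ ∀ f ∈ A.DomPow s, ∀ F : Finset (Fin m × ℕ),
      ∑ p ∈ F, ‖inner ℂ (A.φ p) f‖ ≤ C * A.powNorm s f := by
  have hw := hyp.summable_inv_weight hs
  refine ⟨Real.sqrt (∑' p, (A.weight s p)⁻¹), Real.sqrt_nonneg _, fun f hf F => ?_⟩
  have hnn : ∀ p, 0 ≤ A.weight s p * ‖inner ℂ (A.φ p) f‖ ^ 2 := fun p =>
    mul_nonneg (A.weight_nonneg s p) (sq_nonneg _)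
  rw [powNorm, ← Real.sqrt_mul (tsum_nonneg fun p => inv_nonneg.2 (A.weight_nonneg s p))]
  refine Real.le_sqrt_of_sq_le ?_
  refine (Finset.sum_sq_le_sum_mul_sum_of_sq_le_mul F
    (fun p _ => inv_nonneg.2 (A.weight_nonneg s p)) (fun p _ => hnn p)
    fun p _ => le_of_eq ?_).trans ?_
  · rw [inv_mul_cancel_left₀ (A.weight_pos s p).ne']
  · exact mul_le_mul (hw.sum_le_tsum _ fun p _ => inv_nonneg.2 (A.weight_nonneg s p))
      (hf.sum_le_tsum _ fun p _ => hnn p) (Finset.sum_nonneg fun p _ => hnn p)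
      (tsum_nonneg fun p => inv_nonneg.2 (A.weight_nonneg s p))

/-- The vectors whose coordinates in the eigenbasis are absolutely summable. -/
def summableCoords (A : DiagonalOperator H m) : Submodule ℂ H where
  carrier := {f | Summable fun p => ‖inner ℂ (A.φ p) f‖}
  zero_mem' := by simp
  add_mem' := by
    intro f g hf hg
    refine Summable.of_nonneg_of_le (fun _ => norm_nonneg _) (fun p => ?_) (hf.add hg)
    rw [inner_add_right]
    exact norm_add_le _ _
  smul_mem' := by
    intro a f hf
    refine (hf.mul_left ‖a‖).congr fun p => ?_
    rw [inner_smul_right, norm_mul]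

/-- The domain of the feedback: the union of the spaces `D(A^s)`, `s > 1 / (2 α)`. -/
def feedbackDomain (A : DiagonalOperator H m) (α : ℝ) : Submodule ℂ H :=
  ⨆ (s : ℝ) (_ : 1 / (2 * α) < s), A.DomPow s

theorem domPow_le_feedbackDomain {s : ℝ} (hs : 1 / (2 * α) < s) :
    A.DomPow s ≤ A.feedbackDomain α :=
  le_iSup₂ (f := fun (s : ℝ) (_ : 1 / (2 * α) < s) => A.DomPow s) s hs

theorem Framework.feedbackDomain_le (hyp : A.Framework α e B) :
    A.feedbackDomain α ≤ A.summableCoords := by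
  refine iSup₂_le fun s hs f hf => ?_
  obtain ⟨C, _, hC⟩ := hyp.exists_sum_norm_inner_le hs
  exact summable_of_sum_le (fun _ => norm_nonneg _) (hC f hf)

/-- Makes `s = 1 / 2` admissible, the exponent used both for the closed-loop domain and for `T B =
B`. -/
theorem Framework.inv_two_mul_lt (hyp : A.Framework α e B) : 1 / (2 * α) < 1 / 2 :=
  one_div_lt_one_div_of_lt two_pos (by linarith [hyp.one_lt])

theorem weight_one (p : Fin m × ℕ) : A.weight 1 p = 1 + ‖A.ev p.1 p.2‖ ^ 2 := Real.rpow_one _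

theorem hasSum_weight_one (f : A.op.domain) :
    HasSum (fun p => A.weight 1 p * ‖inner ℂ (A.φ p) (f : H)‖ ^ 2)
      (‖(f : H)‖ ^ 2 + ‖A.op f‖ ^ 2) := by
  refine ((hasSum_norm_inner_sq A.φ (f : H)).add (hasSum_norm_inner_sq A.φ (A.op f))).congr_fun
    fun p => ?_
  rw [weight_one, inner_op, norm_mul]
  ring

theorem Framework.domain_le (hyp : A.Framework α e B) : A.op.domain ≤ A.feedbackDomain α :=
  fun f hf => domPow_le_feedbackDomain (s := 1) (hyp.inv_two_mul_lt.trans (by norm_num))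
    (hasSum_weight_one ⟨f, hf⟩).summable

theorem summable_mul_inner {f : H} (hf : f ∈ A.summableCoords) {k : Fin m → ℕ → ℂ} {C : ℝ}
    (hk : ∀ i n, ‖k i n‖ ≤ C) (i : Fin m) :
    Summable fun n => k i n * inner ℂ (A.φ (i, n)) f := by
  have h1 : Summable fun n => ‖inner ℂ (A.φ (i, n)) f‖ :=
    Summable.comp_injective (i := fun n => (i, n)) hf fun a b hab => (Prod.ext_iff.1 hab).2
  refine Summable.of_norm_bounded (h1.mul_left C) fun n => ?_
  rw [norm_mul]
  exact mul_le_mul_of_nonneg_right (hk i n) (norm_nonneg _)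

theorem norm_tsum_mul_inner_le {f : H} {k : Fin m → ℕ → ℂ} {C D : ℝ} (hC : 0 ≤ C)
    (hk : ∀ i n, ‖k i n‖ ≤ C) (hf : ∀ F : Finset (Fin m × ℕ), ∑ p ∈ F, ‖inner ℂ (A.φ p) f‖ ≤ D)
    (i : Fin m) : ‖∑' n, k i n * inner ℂ (A.φ (i, n)) f‖ ≤ C * D := by
  have hsum := summable_mul_inner (A := A) (summable_of_sum_le (fun _ => norm_nonneg _) hf) hk i
  refine le_of_tendsto ((continuous_norm.tendsto _).comp hsum.hasSum)
    (Eventually.of_forall fun s => ?_)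
  calc ‖∑ n ∈ s, k i n * inner ℂ (A.φ (i, n)) f‖
      ≤ ∑ n ∈ s, C * ‖inner ℂ (A.φ (i, n)) f‖ := by
        refine (norm_sum_le _ _).trans (Finset.sum_le_sum fun n _ => ?_)
        rw [norm_mul]
        exact mul_le_mul_of_nonneg_right (hk i n) (norm_nonneg _)
    _ = C * ∑ p ∈ s.map ⟨fun n => (i, n), fun a b hab => (Prod.ext_iff.1 hab).2⟩,
          ‖inner ℂ (A.φ p) f‖ := by
        rw [Finset.mul_sum, Finset.sum_map]
        rfl
    _ ≤ C * D := mul_le_mul_of_nonneg_left (hf _) hC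

/-- The scalar feedback acting in the `i`-th block. -/
noncomputable def gainSum (e : Module.Basis (Fin m) ℂ U) (B : U →ₗ[ℂ] A.Dual) (μ : ℝ) (f : H)
    (i : Fin m) : ℂ :=
  ∑' n, A.gain e B μ i n * inner ℂ (A.φ (i, n)) f

theorem Framework.exists_feedback (hyp : A.Framework α e B) (h : A.Estimates e B μ R) :
    ∃ K : H →ₗ.[ℂ] U, A.IsFeedback α e B μ K ∧ K.domain = A.feedbackDomain α ∧
      ∀ f : K.domain, K f = ∑ i, gainSum e B μ (f : H) i • e i := by
  obtain ⟨C, hC0, hC⟩ := h.exists_norm_gain_le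
  have hsum : ∀ (f : A.feedbackDomain α) i,
      Summable fun n => A.gain e B μ i n * inner ℂ (A.φ (i, n)) (f : H) := fun f i =>
    summable_mul_inner (hyp.feedbackDomain_le f.2) hC i
  let K : H →ₗ.[ℂ] U :=
    { domain := A.feedbackDomain α
      toFun :=
        { toFun := fun f => ∑ i, gainSum e B μ (f : H) i • e i
          map_add' := fun f g => by
            rw [← Finset.sum_add_distrib]
            refine Finset.sum_congr rfl fun i _ => ?_
            rw [← add_smul]
            congr 1
            rw [gainSum, gainSum, gainSum, ← (hsum f i).tsum_add (hsum g i)]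
            exact tsum_congr fun n => by rw [Submodule.coe_add, inner_add_right, mul_add]
          map_smul' := fun a f => by
            rw [RingHom.id_apply, Finset.smul_sum]
            refine Finset.sum_congr rfl fun i _ => ?_
            rw [smul_smul]
            congr 1
            rw [gainSum, gainSum, ← tsum_mul_left]
            exact tsum_congr fun n => by rw [Submodule.coe_smul, inner_smul_right]; ring } }
  have hK : ∀ f : K.domain, K f = ∑ i, gainSum e B μ (f : H) i • e i := fun _ => rfl
  refine ⟨K, ⟨rfl, fun s hs => ?_, fun i n => ?_⟩, rfl, hK⟩
  · obtain ⟨D, hD0, hD⟩ := hyp.exists_sum_norm_inner_le hs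
    refine ⟨∑ i, C * D * ‖e i‖, fun f hf => ?_⟩
    rw [hK, Finset.sum_mul]
    refine (norm_sum_le _ _).trans (Finset.sum_le_sum fun i _ => ?_)
    rw [norm_smul, mul_right_comm]
    refine mul_le_mul_of_nonneg_right ?_ (norm_nonneg _)
    rw [mul_assoc]
    exact norm_tsum_mul_inner_le hC0 hC (hD f hf) i
  · refine LinearPMap.mem_graph_iff K |>.2
      ⟨⟨A.φ (i, n), hyp.domain_le (A.mem_domain (i, n))⟩, rfl, ?_⟩
    rw [hK, Finset.sum_eq_single i]
    · congr 1
      rw [gainSum, tsum_eq_single n]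
      · rw [inner_basis_eq_ite, if_pos rfl, mul_one]
      · intro k hk
        simp [inner_basis_eq_ite, hk]
    · intro j _ hj
      have : gainSum e B μ (A.φ (i, n)) j = 0 := by
        rw [gainSum]
        simp [inner_basis_eq_ite, hj]
      rw [this, zero_smul]
    · intro hi
      exact absurd (Finset.mem_univ i) hi

namespace Estimates

theorem control_basisVec (h : A.Estimates e B μ R) (c : Fin m → ℂ) (j : Fin m) (n : ℕ) :
    (B (∑ i, c i • e i)).1 (A.basisVec (j, n)) = c j * A.coeff e B j n := by
  have : (B (∑ i, c i • e i)).1 (A.basisVec (j, n)) =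
      ∑ i, c i * (B (e i)).1 (A.basisVec (j, n)) := by
    simp [map_sum]
  rw [this, Finset.sum_eq_single j]
  · rfl
  · intro i _ hij
    rw [h.block i j n hij, mul_zero]
  · intro hj
    exact absurd (Finset.mem_univ j) hj

/-- Termwise, `t_{jn} λ_n = (λ_j - μ) t_{jn} - b_j k_n`. Summable coordinates allow the series to be
split even when `f` is not in `D(A)`. -/
theorem hasSum_transEntry_ev_mul (h : A.Estimates e B μ R) {T : H →L[ℂ] H}
    (hT : ∀ x i j, HasSum (fun n => transEntry e B μ i j n * inner ℂ (A.φ (i, n)) x)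
      (inner ℂ (A.φ (i, j)) (T x))) {f : H} (hf : f ∈ A.summableCoords) (i : Fin m) (j : ℕ) :
    HasSum (fun n => transEntry e B μ i j n * (A.ev i n * inner ℂ (A.φ (i, n)) f))
      ((A.ev i j - μ) * inner ℂ (A.φ (i, j)) (T f) - A.coeff e B i j * gainSum e B μ f i) := by
  obtain ⟨C, hC0, hC⟩ := h.exists_norm_gain_le
  refine (((hT f i j).mul_left (A.ev i j - μ)).sub
    ((summable_mul_inner hf hC i).hasSum.mul_left (A.coeff e B i j))).congr_fun fun n => ?_
  have h1 := h.shift_ne i j n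
  rw [transEntry]
  field_simp
  ring

theorem hasSum_invTransEntry_ev_mul (h : A.Estimates e B μ R) {S : H →L[ℂ] H}
    (hS : ∀ x i n, HasSum (fun j => invTransEntry e B μ i n j * inner ℂ (A.φ (i, j)) x)
      (inner ℂ (A.φ (i, n)) (S x))) {f : H} (hf : f ∈ A.summableCoords) (i : Fin m) (n : ℕ) :
    HasSum (fun j => invTransEntry e B μ i n j * (A.ev i j * inner ℂ (A.φ (i, j)) f))
      ((A.ev i n + μ) * inner ℂ (A.φ (i, n)) (S f) +
        A.coeff e B i n * ∑' j, invGain e B μ i j * inner ℂ (A.φ (i, j)) f) := by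
  obtain ⟨C, hC0, hC⟩ := h.exists_norm_invGain_le
  refine (((hS f i n).mul_left (A.ev i n + μ)).add
    ((summable_mul_inner hf hC i).hasSum.mul_left (A.coeff e B i n))).congr_fun fun j => ?_
  have h1 := h.shift_ne i j n
  rw [invTransEntry]
  field_simp
  ring

theorem intertwining (hyp : A.Framework α e B) (h : A.Estimates e B μ R) {T : H →L[ℂ] H}
    (hT : ∀ x i j, HasSum (fun n => transEntry e B μ i j n * inner ℂ (A.φ (i, n)) x)
      (inner ℂ (A.φ (i, j)) (T x))) (f : A.op.domain) :
    A.pivot (T (A.op f)) + B (∑ i, gainSum e B μ (f : H) i • e i) =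
      A.extend (T f) - (μ : ℂ) • A.pivot (T f) := by
  refine A.dual_ext fun p => ?_
  obtain ⟨i, j⟩ := p
  have h1 := h.hasSum_transEntry_ev_mul hT (hyp.feedbackDomain_le (hyp.domain_le f.2)) i j
  have h2 := hT (A.op f) i j
  simp only [inner_op] at h2
  have h3 := h2.unique h1
  change (A.pivot (T (A.op f))).1 (A.basisVec (i, j)) +
    (B (∑ i, gainSum e B μ (f : H) i • e i)).1 (A.basisVec (i, j)) =
    (A.extend (T f)).1 (A.basisVec (i, j)) - (μ : ℂ) * (A.pivot (T f)).1 (A.basisVec (i, j))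
  rw [h.control_basisVec, pivot_basisVec, pivot_basisVec, extend_basisVec, h3]
  ring

/-- Coordinates of `y = A x + B c`, for scalar controls `c i`, after the transform. -/
theorem inner_transform_of_inner (h : A.Estimates e B μ R) {T : H →L[ℂ] H}
    (hT : ∀ x i j, HasSum (fun n => transEntry e B μ i j n * inner ℂ (A.φ (i, n)) x)
      (inner ℂ (A.φ (i, j)) (T x))) {x y : H} (hx : x ∈ A.summableCoords) {c : Fin m → ℂ}
    (hc : ∀ i n, inner ℂ (A.φ (i, n)) y =
      A.ev i n * inner ℂ (A.φ (i, n)) x + c i * A.coeff e B i n) (i : Fin m) (j : ℕ) :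
    inner ℂ (A.φ (i, j)) (T y) = (A.ev i j - μ) * inner ℂ (A.φ (i, j)) (T x) +
      A.coeff e B i j * (c i - gainSum e B μ x i) := by
  refine (hT y i j).unique ?_
  have hs := (h.hasSum_transEntry_ev_mul hT hx i j).add
    ((h.hasSum_transEntry_coeff i j).mul_left (c i))
  convert! hs using 1
  · funext n
    rw [hc]
    ring
  · ring

/-- With `w = (1 + |λ|²)^{1/2}` the hypothesis bounds `w |x_p|` by `|x_p| + |y_p| + D`. Writing `w
|x_p|² = w⁻¹ (w |x_p|)²`, the constant `D` is harmless because `∑ w⁻¹` converges. -/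
theorem mem_domPow_half (hyp : A.Framework α e B) {x y : H} {D : ℝ}
    (hD : ∀ p : Fin m × ℕ, ‖A.ev p.1 p.2 * inner ℂ (A.φ p) x‖ ≤ ‖inner ℂ (A.φ p) y‖ + D) :
    x ∈ A.DomPow (1 / 2) := by
  have hw := hyp.summable_inv_weight hyp.inv_two_mul_lt
  have hx := (hasSum_norm_inner_sq A.φ x).summable
  have hy := (hasSum_norm_inner_sq A.φ y).summable
  refine Summable.of_nonneg_of_le (fun p => mul_nonneg (A.weight_nonneg _ p) (sq_nonneg _))
    (fun p => ?_) (((hx.add hy).mul_left 3).add (hw.mul_left (3 * D ^ 2)))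
  have hp := hD p
  rw [norm_mul] at hp
  have hw0 := A.weight_pos (1 / 2) p
  have hwsq : A.weight (1 / 2) p ^ 2 = 1 + ‖A.ev p.1 p.2‖ ^ 2 := by
    rw [weight, ← Real.sqrt_eq_rpow, Real.sq_sqrt (by positivity)]
  set w := A.weight (1 / 2) p
  set a := ‖inner ℂ (A.φ p) x‖
  set b := ‖inner ℂ (A.φ p) y‖
  set l := ‖A.ev p.1 p.2‖
  have hl : 0 ≤ l := norm_nonneg _
  have ha : 0 ≤ a := norm_nonneg _
  have hb : 0 ≤ b := norm_nonneg _
  have hw1 : 1 ≤ w := by nlinarith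
  have hwl : w ≤ 1 + l := by nlinarith
  have hwa : w * a ≤ a + (b + D) := by nlinarith
  have h1 : (w * a) ^ 2 ≤ 3 * (a ^ 2 + b ^ 2) + 3 * D ^ 2 := by
    have := pow_le_pow_left₀ (by positivity) hwa 2
    nlinarith [sq_nonneg (a - b), sq_nonneg (a - D), sq_nonneg (b - D)]
  have h2 : w * a ^ 2 = w⁻¹ * (w * a) ^ 2 := by field_simp
  rw [h2]
  calc w⁻¹ * (w * a) ^ 2 ≤ w⁻¹ * (3 * (a ^ 2 + b ^ 2) + 3 * D ^ 2) := by gcongr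
    _ = w⁻¹ * (3 * (a ^ 2 + b ^ 2)) + 3 * D ^ 2 * w⁻¹ := by ring
    _ ≤ 3 * (a ^ 2 + b ^ 2) + 3 * D ^ 2 * w⁻¹ := by
        exact add_le_add_left
          (mul_le_of_le_one_left (by positivity) (inv_le_one_of_one_le₀ hw1)) _

/-- The identity `A + B K = T⁻¹ (A - μ) T` with equality of domains. The delicate direction recovers
`x ∈ D(K)` from `T x ∈ D(A)` by a regularity argument. -/
theorem mem_closedLoop_iff (hyp : A.Framework α e B) (h : A.Estimates e B μ R) {T : H ≃L[ℂ] H}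
    (hT : ∀ x i j, HasSum (fun n => transEntry e B μ i j n * inner ℂ (A.φ (i, n)) x)
      (inner ℂ (A.φ (i, j)) (T x)))
    (hS : ∀ x i n, HasSum (fun j => invTransEntry e B μ i n j * inner ℂ (A.φ (i, j)) x)
      (inner ℂ (A.φ (i, n)) (T.symm x))) {K : H →ₗ.[ℂ] U} (hdom : K.domain = A.feedbackDomain α)
    (hK : ∀ f : K.domain, K f = ∑ i, gainSum e B μ (f : H) i • e i) (x y : H) :
    (x, y) ∈ A.closedLoop B K ↔ (T x, T y + (μ : ℂ) • T x) ∈ A.op.graph := by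
  constructor
  · rintro ⟨hx, hxy⟩
    change A.extend x + B (K ⟨x, hx⟩) = A.pivot y at hxy
    change x ∈ K.domain at hx
    have hx' : x ∈ A.summableCoords := hyp.feedbackDomain_le (hdom ▸ hx)
    have hc : ∀ i n, inner ℂ (A.φ (i, n)) y =
        A.ev i n * inner ℂ (A.φ (i, n)) x + gainSum e B μ x i * A.coeff e B i n := by
      intro i n
      have := congrArg (fun l : A.Dual => l.1 (A.basisVec (i, n))) hxy
      change (A.extend x).1 _ + (B (K ⟨x, hx⟩)).1 _ = (A.pivot y).1 _ at this
      rw [hK, h.control_basisVec, pivot_basisVec, extend_basisVec] at this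
      exact this.symm
    have hTy := h.inner_transform_of_inner (T := (T : H →L[ℂ] H)) hT hx' hc
    obtain ⟨hh, hop⟩ := A.mem_domain_of_inner (h := T x) (w := T y + (μ : ℂ) • T x) fun p => by
      have := hTy p.1 p.2
      simp only [ContinuousLinearEquiv.coe_coe] at this
      rw [inner_add_right, inner_smul_right, this]
      ring
    exact (LinearPMap.mem_graph_iff _).2 ⟨⟨T x, hh⟩, rfl, hop⟩
  · intro hg
    obtain ⟨⟨h', hh⟩, rfl, hop⟩ := (LinearPMap.mem_graph_iff _).1 hg
    change A.op ⟨T x, hh⟩ = T y + (μ : ℂ) • T x at hop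
    have hsum : T x ∈ A.summableCoords := hyp.feedbackDomain_le (hyp.domain_le hh)
    -- The control read off from `T x` through the inverse transform: it satisfies `A x + B c = y`,
    -- whence `x ∈ D(A^{1/2})`.
    let c : Fin m → ℂ := fun i => ∑' j, invGain e B μ i j * inner ℂ (A.φ (i, j)) (T x)
    have hc : ∀ i n, inner ℂ (A.φ (i, n)) y =
        A.ev i n * inner ℂ (A.φ (i, n)) x + c i * A.coeff e B i n := by
      intro i n
      have h1 := h.hasSum_invTransEntry_ev_mul (S := (T.symm : H →L[ℂ] H)) hS hsum i n
      have h2 := hS (A.op ⟨T x, hh⟩) i n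
      simp only [inner_op] at h2
      have h3 := h2.unique h1
      simp only [hop, map_add, map_smul, ContinuousLinearEquiv.symm_apply_apply,
        ContinuousLinearEquiv.coe_coe, inner_add_right, inner_smul_right] at h3
      linear_combination h3
    have hbound : ∀ p : Fin m × ℕ, ‖A.ev p.1 p.2 * inner ℂ (A.φ p) x‖ ≤
        ‖inner ℂ (A.φ p) y‖ + (∑ i, ‖c i‖) * R := by
      rintro ⟨i, n⟩
      have e1 : A.ev i n * inner ℂ (A.φ (i, n)) x =
          inner ℂ (A.φ (i, n)) y - c i * A.coeff e B i n := by
        rw [hc]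
        ring
      rw [e1]
      refine (norm_sub_le _ _).trans (add_le_add_right ?_ _)
      rw [norm_mul]
      exact mul_le_mul (Finset.single_le_sum (f := fun i => ‖c i‖) (fun _ _ => norm_nonneg _)
        (Finset.mem_univ i)) (h.norm_coeff_le i n) (norm_nonneg _)
        (Finset.sum_nonneg fun _ _ => norm_nonneg _)
    have hx : x ∈ A.feedbackDomain α :=
      domPow_le_feedbackDomain hyp.inv_two_mul_lt (mem_domPow_half hyp hbound)
    have hTy := h.inner_transform_of_inner (T := (T : H →L[ℂ] H)) hT
      (hyp.feedbackDomain_le hx) hc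
    -- Two expressions for the coordinates of `A T x` differ by `b_{i,n} (c_i - (K x)_i)`; as
    -- `b_{i,0} ≠ 0`, one coordinate per block suffices.
    have hcg : ∀ i, c i = gainSum e B μ x i := by
      intro i
      have h1 := hTy i 0
      have h2 := inner_op A (i, 0) ⟨T x, hh⟩
      rw [hop, inner_add_right, inner_smul_right] at h2
      simp only [ContinuousLinearEquiv.coe_coe] at h1 h2
      have h3 : A.coeff e B i 0 * (c i - gainSum e B μ x i) = 0 := by
        linear_combination h2 - h1
      exact sub_eq_zero.1 ((mul_eq_zero.1 h3).resolve_left (h.coeff_ne i 0))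
    have hx' : x ∈ K.domain := hdom ▸ hx
    refine ⟨hx', A.dual_ext fun p => ?_⟩
    change (A.extend x).1 (A.basisVec p) + (B (K ⟨x, hx'⟩)).1 (A.basisVec p) =
      (A.pivot y).1 (A.basisVec p)
    obtain ⟨i, n⟩ := p
    rw [hK, h.control_basisVec, pivot_basisVec, extend_basisVec, hc, hcg]

end Estimates

end DiagonalOperator

/-! ### Extension of the transform to `D(A^{1/2})'` and the identity `T B = B`. -/

namespace DiagonalOperator

variable {H : Type*} [NormedAddCommGroup H] [InnerProductSpace ℂ H] [CompleteSpace H] {m : ℕ}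
  {A : DiagonalOperator H m} {U : Type*} [NormedAddCommGroup U] [NormedSpace ℂ U] {α : ℝ}
  {e : Module.Basis (Fin m) ℂ U} {B : U →ₗ[ℂ] A.Dual} {μ R : ℝ}

/-- The square root of the weight of `D(A^{1/2})`. -/
noncomputable def halfWeight (A : DiagonalOperator H m) (p : Fin m × ℕ) : ℝ :=
  Real.sqrt (A.weight (1 / 2) p)

theorem halfWeight_pos (A : DiagonalOperator H m) (p : Fin m × ℕ) : 0 < A.halfWeight p :=
  Real.sqrt_pos.2 (A.weight_pos _ p)

theorem halfWeight_sq (A : DiagonalOperator H m) (p : Fin m × ℕ) :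
    A.halfWeight p ^ 2 = A.weight (1 / 2) p :=
  Real.sq_sqrt (A.weight_nonneg _ p)

theorem ofReal_halfWeight_ne (A : DiagonalOperator H m) (p : Fin m × ℕ) :
    (A.halfWeight p : ℂ) ≠ 0 :=
  Complex.ofReal_ne_zero.2 (A.halfWeight_pos p).ne'

theorem norm_ofReal_halfWeight (A : DiagonalOperator H m) (p : Fin m × ℕ) :
    ‖(A.halfWeight p : ℂ)‖ = A.halfWeight p := by
  rw [Complex.norm_real, Real.norm_of_nonneg (A.halfWeight_pos p).le]

theorem weight_half_sq (p : Fin m × ℕ) : A.weight (1 / 2) p ^ 2 = 1 + ‖A.ev p.1 p.2‖ ^ 2 := by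
  rw [weight, ← Real.sqrt_eq_rpow, Real.sq_sqrt (by positivity)]

theorem one_le_weight_half (p : Fin m × ℕ) : 1 ≤ A.weight (1 / 2) p := by
  nlinarith [A.weight_half_sq p, A.weight_pos (1 / 2) p, sq_nonneg ‖A.ev p.1 p.2‖]

/-- The function `λ ↦ (1 + |λ|²)^{1/2}` is 1-Lipschitz. This lets a difference of weights cancel the
Cauchy denominator. -/
theorem abs_weight_half_sub_le (p q : Fin m × ℕ) :
    |A.weight (1 / 2) p - A.weight (1 / 2) q| ≤ ‖A.ev p.1 p.2 - A.ev q.1 q.2‖ := by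
  have key : ∀ p q : Fin m × ℕ,
      A.weight (1 / 2) p - A.weight (1 / 2) q ≤ ‖A.ev p.1 p.2 - A.ev q.1 q.2‖ := by
    intro p q
    have h1 := A.weight_half_sq p
    have h2 := A.weight_half_sq q
    have h3 := A.weight_pos (1 / 2) p
    have h4 := A.weight_pos (1 / 2) q
    have h5 := norm_sub_norm_le (A.ev p.1 p.2) (A.ev q.1 q.2)
    set d := ‖A.ev p.1 p.2 - A.ev q.1 q.2‖
    have hd : 0 ≤ d := norm_nonneg _
    set a := ‖A.ev p.1 p.2‖
    set b := ‖A.ev q.1 q.2‖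
    have ha : 0 ≤ a := norm_nonneg _
    have hb : 0 ≤ b := norm_nonneg _
    have h6 : b ≤ A.weight (1 / 2) q := by nlinarith
    rw [sub_le_iff_le_add]
    refine le_of_sq_le_sq ?_ (by positivity)
    have h7 : a ^ 2 ≤ (d + b) ^ 2 := pow_le_pow_left₀ ha (by linarith) 2
    nlinarith [mul_le_mul_of_nonneg_left h6 hd]
  refine abs_sub_le_iff.2 ⟨key p q, ?_⟩
  rw [norm_sub_rev]
  exact key q p

/-- The operator `D(A) → H` that multiplies the coordinates by `halfWeight`. -/
theorem exists_halfPower (A : DiagonalOperator H m) : ∃ D : A.op.domain →ₗ[ℂ] H,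
    (∀ v p, inner ℂ (A.φ p) (D v) = A.halfWeight p * inner ℂ (A.φ p) (v : H)) ∧
    (∀ v, ‖D v‖ = A.powNorm (1 / 2) v) ∧ ∀ v, ‖D v‖ ≤ ‖(v : H)‖ + ‖A.op v‖ := by
  have hsq : ∀ (v : A.op.domain) p, ‖(A.halfWeight p : ℂ) * inner ℂ (A.φ p) (v : H)‖ ^ 2 =
      A.weight (1 / 2) p * ‖inner ℂ (A.φ p) (v : H)‖ ^ 2 := by
    intro v p
    rw [norm_mul, norm_ofReal_halfWeight, mul_pow, halfWeight_sq]
  have hle : ∀ (v : A.op.domain) p, A.weight (1 / 2) p * ‖inner ℂ (A.φ p) (v : H)‖ ^ 2 ≤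
      A.weight 1 p * ‖inner ℂ (A.φ p) (v : H)‖ ^ 2 := by
    intro v p
    refine mul_le_mul_of_nonneg_right ?_ (sq_nonneg _)
    rw [weight_one, ← weight_half_sq]
    exact le_self_pow₀ (A.one_le_weight_half p) two_ne_zero
  have hsum : ∀ v : A.op.domain,
      Summable fun p => ‖(A.halfWeight p : ℂ) * inner ℂ (A.φ p) (v : H)‖ ^ 2 := by
    intro v
    refine Summable.of_nonneg_of_le (fun _ => sq_nonneg _) (fun p => ?_)
      (hasSum_weight_one v).summable
    rw [hsq]
    exact hle v p
  choose D hD using fun v => exists_inner_eq A.φ (hsum v)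
  refine ⟨{ toFun := D
            map_add' := fun v w => eq_of_forall_inner_eq A.φ fun p => by
              rw [inner_add_right, hD, hD, hD, Submodule.coe_add, inner_add_right, mul_add]
            map_smul' := fun a v => eq_of_forall_inner_eq A.φ fun p => by
              rw [RingHom.id_apply, inner_smul_right, hD, hD, Submodule.coe_smul,
                inner_smul_right]
              ring }, hD, fun v => ?_, fun v => ?_⟩
  · have h1 := hasSum_norm_inner_sq A.φ (D v)
    simp only [hD, hsq] at h1
    change ‖D v‖ = _
    rw [powNorm, h1.tsum_eq, Real.sqrt_sq (norm_nonneg _)]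
  · have h1 := hasSum_norm_inner_sq A.φ (D v)
    simp only [hD, hsq] at h1
    have h2 := hasSum_le (hle v) h1 (hasSum_weight_one v)
    change ‖D v‖ ≤ _
    refine le_of_sq_le_sq (h2.trans ?_) (by positivity)
    nlinarith [mul_nonneg (norm_nonneg (v : H)) (norm_nonneg (A.op v))]

/-- Duality: `l` is tested on the finite vector with coordinates `l (φ p) / halfWeight p ^ 2`, which
yields `S ≤ C * √S`. -/
theorem sum_norm_dual_sq_le {l : A.Dual} {C : ℝ}
    (hl : ∀ v : A.op.domain, ‖l.1 v‖ ≤ C * A.powNorm (1 / 2) v) (F : Finset (Fin m × ℕ)) :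
    ∑ p ∈ F, ‖l.1 (A.basisVec p) / A.halfWeight p‖ ^ 2 ≤ C ^ 2 := by
  set S := ∑ p ∈ F, ‖l.1 (A.basisVec p) / A.halfWeight p‖ ^ 2 with hS
  have hS0 : 0 ≤ S := Finset.sum_nonneg fun _ _ => sq_nonneg _
  let c : Fin m × ℕ → ℂ := fun p => l.1 (A.basisVec p) / (A.halfWeight p : ℂ) ^ 2
  let v : A.op.domain := ∑ p ∈ F, c p • A.basisVec p
  have hc : ∀ p, starRingEnd ℂ (c p) * l.1 (A.basisVec p) =
      ((‖l.1 (A.basisVec p) / A.halfWeight p‖ ^ 2 : ℝ) : ℂ) := by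
    intro p
    have h0 := A.ofReal_halfWeight_ne p
    rw [norm_div, norm_ofReal_halfWeight, div_pow, Complex.ofReal_div, Complex.ofReal_pow,
      Complex.ofReal_pow, ← Complex.conj_mul']
    simp only [c, map_div₀, map_pow, Complex.conj_ofReal]
    ring
  have hlv : l.1 v = (S : ℂ) := by
    simp only [v, map_sum, LinearMap.map_smulₛₗ, smul_eq_mul, hc, hS]
    push_cast
    rfl
  have hv : ∀ q, inner ℂ (A.φ q) (v : H) = if q ∈ F then c q else 0 := by
    intro q
    have : (v : H) = ∑ p ∈ F, c p • A.φ p := by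
      simp only [v, Submodule.coe_sum, Submodule.coe_smul]
      rfl
    rw [this, inner_sum]
    simp only [inner_smul_right, inner_basis_eq_ite, mul_ite, mul_one, mul_zero]
    exact Finset.sum_ite_eq F q c
  have hpow : A.powNorm (1 / 2) v = Real.sqrt S := by
    rw [powNorm, tsum_eq_sum (s := F) fun q hq => by rw [hv, if_neg hq]; simp]
    congr 1
    refine Finset.sum_congr rfl fun p hp => ?_
    have h0 := (A.halfWeight_pos p).ne'
    rw [hv, if_pos hp, ← halfWeight_sq, norm_div, norm_div, norm_pow, norm_ofReal_halfWeight]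
    field_simp
  have h1 := hl v
  rw [hlv, hpow, Complex.norm_real, Real.norm_of_nonneg hS0] at h1
  have h2 : S ^ 2 ≤ C ^ 2 * S := by
    have := pow_le_pow_left₀ hS0 h1 2
    rwa [mul_pow, Real.sq_sqrt hS0] at this
  rcases hS0.eq_or_lt with h3 | h3
  · rw [← h3]
    exact sq_nonneg C
  · rw [sq] at h2
    exact le_of_mul_le_mul_right h2 h3

/-- `D(A^{1/2})'` is isomorphic to `H`: a functional `l` corresponds to the vector with
coordinates `l (φ p) / halfWeight p`. -/
theorem exists_dualPow_equiv (A : DiagonalOperator H m) :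
    ∃ (J : H →ₗ[ℂ] A.DualPow (1 / 2)) (Q : A.DualPow (1 / 2) →ₗ[ℂ] H),
      (∀ y p, (J y).1.1 (A.basisVec p) = A.halfWeight p * inner ℂ (A.φ p) y) ∧
      (∀ y v, ‖(J y).1.1 v‖ ≤ ‖y‖ * A.powNorm (1 / 2) v) ∧
      (∀ l p, inner ℂ (A.φ p) (Q l) = l.1.1 (A.basisVec p) / A.halfWeight p) ∧
      ∀ (l : A.DualPow (1 / 2)) (C : ℝ),
        (∀ v : A.op.domain, ‖l.1.1 v‖ ≤ C * A.powNorm (1 / 2) v) → ‖Q l‖ ≤ |C| := by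
  obtain ⟨D, hD, hDnorm, hDle⟩ := A.exists_halfPower
  have hpn : ∀ v : A.op.domain, A.powNorm (1 / 2) v ≤ ‖(v : H)‖ + ‖A.op v‖ := fun v =>
    hDnorm v ▸ hDle v
  let J₀ : H → A.op.domain →ₗ⋆[ℂ] ℂ := fun y =>
    { toFun := fun v => inner ℂ (D v) y
      map_add' := fun v w => by rw [map_add, inner_add_left]
      map_smul' := fun a v => by rw [map_smul, inner_smul_left, smul_eq_mul] }
  have hJ₀ : ∀ y v, ‖J₀ y v‖ ≤ ‖y‖ * A.powNorm (1 / 2) v := by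
    intro y v
    rw [← hDnorm, mul_comm]
    exact norm_inner_le_norm _ _
  let J : H →ₗ[ℂ] A.DualPow (1 / 2) :=
    { toFun := fun y => ⟨⟨J₀ y, ‖y‖, fun v => (hJ₀ y v).trans
        (mul_le_mul_of_nonneg_left (hpn v) (norm_nonneg y))⟩, ‖y‖, hJ₀ y⟩
      map_add' := fun y z => Subtype.ext (Subtype.ext (LinearMap.ext fun v =>
        inner_add_right (D v) y z))
      map_smul' := fun a y => Subtype.ext (Subtype.ext (LinearMap.ext fun v =>
        inner_smul_right (D v) y a)) }
  have hQ : ∀ l : A.DualPow (1 / 2), ∃ y : H,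
      ∀ p, inner ℂ (A.φ p) y = l.1.1 (A.basisVec p) / A.halfWeight p := by
    intro l
    obtain ⟨C, hC⟩ := l.2
    exact exists_inner_eq A.φ
      (summable_of_sum_le (fun _ => sq_nonneg _) (sum_norm_dual_sq_le hC))
  choose Q hQ using hQ
  refine ⟨J, { toFun := Q
               map_add' := fun l l' => eq_of_forall_inner_eq A.φ fun p => by
                rw [inner_add_right, hQ, hQ, hQ, ← add_div]
                rfl
               map_smul' := fun a l => eq_of_forall_inner_eq A.φ fun p => by
                rw [RingHom.id_apply, inner_smul_right, hQ, hQ, ← mul_div_assoc]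
                rfl }, fun y p => ?_, hJ₀, hQ, fun l C hC => ?_⟩
  · change inner ℂ (D (A.basisVec p)) y = _
    have h0 : D (A.basisVec p) = (A.halfWeight p : ℂ) • A.φ p := by
      refine eq_of_forall_inner_eq A.φ fun q => ?_
      rw [hD, inner_smul_right]
      change _ * inner ℂ (A.φ q) (A.φ p) = _
      rw [inner_basis_eq_ite]
      split_ifs with hqp
      · rw [hqp]
      · simp
    rw [h0, inner_smul_left, Complex.conj_ofReal]
  · change ‖Q l‖ ≤ |C|
    refine le_of_sq_le_sq ?_ (abs_nonneg C)
    rw [sq_abs]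
    refine hasSum_le_of_sum_le (hasSum_norm_inner_sq A.φ (Q l)) fun F => ?_
    simp only [hQ]
    exact sum_norm_dual_sq_le hC F

namespace Estimates

/-- The conjugate of the transform by `halfWeight` is bounded: it differs from the transform by a
matrix with entries dominated by `C / (halfWeight j * halfWeight n)`. -/
theorem exists_weighted_transform (hyp : A.Framework α e B) (h : A.Estimates e B μ R)
    {T : H →L[ℂ] H}
    (hT : ∀ x i j, HasSum (fun n => transEntry e B μ i j n * inner ℂ (A.φ (i, n)) x)
      (inner ℂ (A.φ (i, j)) (T x))) :
    ∃ M : H →L[ℂ] H, ∀ x i j, HasSum (fun n => transEntry e B μ i j n *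
        (A.halfWeight (i, n) / A.halfWeight (i, j)) * inner ℂ (A.φ (i, n)) x)
      (inner ℂ (A.φ (i, j)) (M x)) := by
  obtain ⟨C, hC0, hC⟩ := h.exists_norm_gain_le
  have hR := h.nonneg
  have hw := hyp.summable_inv_weight hyp.inv_two_mul_lt
  let W := ∑' p, (A.weight (1 / 2) p)⁻¹
  have hW : ∀ i, ∀ s : Finset ℕ, ∑ n ∈ s, (A.weight (1 / 2) (i, n))⁻¹ ≤ W := by
    intro i s
    have h1 := hw.sum_le_tsum (s.map ⟨fun n => (i, n), fun a b hab => (Prod.ext_iff.1 hab).2⟩)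
      fun p _ => inv_nonneg.2 (A.weight_nonneg _ p)
    rwa [Finset.sum_map] at h1
  let t : Fin m → ℕ → ℕ → ℂ := fun i j n =>
    transEntry e B μ i j n * (A.halfWeight (i, n) / A.halfWeight (i, j) - 1)
  let E := C * R * R
  have hE : 0 ≤ E := by positivity
  have ht : ∀ i j n, ‖t i j n‖ ≤ E * ((A.halfWeight (i, n))⁻¹ * (A.halfWeight (i, j))⁻¹) := by
    intro i j n
    have ha := A.halfWeight_pos (i, n)
    have hb := A.halfWeight_pos (i, j)
    have h1 := h.norm_transEntry_le hC i j n
    have h2 := (A.abs_weight_half_sub_le (i, n) (i, j))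
    rw [norm_sub_rev] at h2
    have h3 := h2.trans (h.norm_ev_sub_le i j n)
    rw [← halfWeight_sq, ← halfWeight_sq] at h3
    have h4 : ‖(A.halfWeight (i, n) / A.halfWeight (i, j) - 1 : ℂ)‖ =
        |A.halfWeight (i, n) - A.halfWeight (i, j)| * (A.halfWeight (i, j))⁻¹ := by
      rw [div_sub_one (A.ofReal_halfWeight_ne (i, j)), norm_div, norm_ofReal_halfWeight,
        ← Complex.ofReal_sub, Complex.norm_real, Real.norm_eq_abs, div_eq_mul_inv]
    set a := A.halfWeight (i, n)
    set b := A.halfWeight (i, j)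
    -- From `|a ^ 2 - b ^ 2| = |a - b| (a + b)` and `a ≤ a + b`.
    have h5 : |a - b| * a ≤ R * ‖A.ev i j - A.ev i n - μ‖ := by
      refine le_trans ?_ h3
      rw [sq_sub_sq, abs_mul, mul_comm]
      refine mul_le_mul_of_nonneg_right ?_ (abs_nonneg _)
      rw [abs_of_pos (by positivity)]
      linarith
    have h6 : |a - b| ≤ R * ‖A.ev i j - A.ev i n - μ‖ * a⁻¹ := by
      rw [← div_eq_mul_inv, le_div_iff₀ ha]
      exact h5
    have h7 : ‖(A.ev i j - A.ev i n - μ)⁻¹‖ * ‖A.ev i j - A.ev i n - μ‖ = 1 := by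
      rw [← norm_mul, inv_mul_cancel₀ (h.shift_ne i j n), norm_one]
    calc ‖t i j n‖ = ‖transEntry e B μ i j n‖ * (|a - b| * b⁻¹) := by rw [norm_mul, h4]
      _ ≤ C * R * ‖(A.ev i j - A.ev i n - μ)⁻¹‖ *
          (R * ‖A.ev i j - A.ev i n - μ‖ * a⁻¹ * b⁻¹) := by gcongr
      _ = E * (a⁻¹ * b⁻¹) * (‖(A.ev i j - A.ev i n - μ)⁻¹‖ * ‖A.ev i j - A.ev i n - μ‖) := by
          ring
      _ = E * (a⁻¹ * b⁻¹) := by rw [h7, mul_one]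
  have hsum : ∀ (i : Fin m) (s : Finset ℕ) (b : ℝ), 0 ≤ b → ∑ n ∈ s,
      E * ((A.halfWeight (i, n))⁻¹ * b) * (A.halfWeight (i, n))⁻¹ ≤ E * W * b := by
    intro i s b hb
    have e1 : ∀ n, E * ((A.halfWeight (i, n))⁻¹ * b) * (A.halfWeight (i, n))⁻¹ =
        E * b * (A.weight (1 / 2) (i, n))⁻¹ := by
      intro n
      rw [← halfWeight_sq, sq, mul_inv]
      ring
    rw [Finset.sum_congr rfl fun n _ => e1 n, ← Finset.mul_sum, mul_right_comm E W b]
    exact mul_le_mul_of_nonneg_left (hW i s) (by positivity)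
  have hinv : ∀ q, 0 < (A.halfWeight q)⁻¹ := fun q => inv_pos.2 (A.halfWeight_pos q)
  -- With Schur weights `1 / halfWeight`, entries bounded by `E / (halfWeight j * halfWeight n)`
  -- only require `∑ halfWeight⁻²` to be finite.
  obtain ⟨N, hN⟩ := exists_block_clm A.φ (t := t) (p := fun q => (A.halfWeight q)⁻¹)
    (R := E * W) hinv
    (fun i j s => (Finset.sum_le_sum fun n _ =>
      mul_le_mul_of_nonneg_right (ht i j n) (hinv _).le).trans (hsum i s _ (hinv _).le))
    (fun i n s => (Finset.sum_le_sum fun j _ => mul_le_mul_of_nonneg_right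
      ((ht i j n).trans_eq (by rw [mul_comm (A.halfWeight (i, n))⁻¹])) (hinv _).le).trans
        (hsum i s _ (hinv _).le))
  refine ⟨T + N, fun x i j => ?_⟩
  rw [add_apply, inner_add_right]
  refine ((hT x i j).add (hN x i j)).congr_fun fun n => ?_
  simp only [t]
  ring

/-- The bounded conjugated matrix, transported to `D(A^{1/2})'`, acts on functionals by the original
matrix of `T`. Thus `T B = B` reduces to `hasSum_transEntry_coeff`. -/
theorem fixesControl (hyp : A.Framework α e B) (h : A.Estimates e B μ R) {T : H →L[ℂ] H}
    (hT : ∀ x i j, HasSum (fun n => transEntry e B μ i j n * inner ℂ (A.φ (i, n)) x)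
      (inner ℂ (A.φ (i, j)) (T x))) : A.FixesControl T B := by
  obtain ⟨M, hM⟩ := h.exists_weighted_transform hyp hT
  obtain ⟨J, Q, hJ, hJnorm, hQ, hQnorm⟩ := A.exists_dualPow_equiv
  let T' : A.DualPow (1 / 2) →ₗ[ℂ] A.DualPow (1 / 2) := J ∘ₗ (M : H →ₗ[ℂ] H) ∘ₗ Q
  have hT' : ∀ (l : A.DualPow (1 / 2)) i j,
      HasSum (fun n => transEntry e B μ i j n * l.1.1 (A.basisVec (i, n)))
        ((T' l).1.1 (A.basisVec (i, j))) := by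
    intro l i j
    change HasSum _ ((J (M (Q l))).1.1 (A.basisVec (i, j)))
    rw [hJ]
    refine ((hM (Q l) i j).mul_left (A.halfWeight (i, j) : ℂ)).congr_fun fun n => ?_
    have h1 := A.ofReal_halfWeight_ne (i, j)
    have h2 := A.ofReal_halfWeight_ne (i, n)
    rw [hQ]
    field_simp
  refine ⟨1 / 2, by norm_num, by norm_num, T', ⟨⟨‖M‖, fun l C hC v => ?_⟩, fun l x hl => ?_⟩,
    fun u => ?_⟩
  · have h1 : |C| * A.powNorm (1 / 2) v = C * A.powNorm (1 / 2) v := by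
      have hp : 0 ≤ A.powNorm (1 / 2) v := Real.sqrt_nonneg _
      rw [← abs_of_nonneg hp, ← abs_mul, abs_of_nonneg ((norm_nonneg _).trans (hC v)),
        abs_of_nonneg hp]
    calc ‖(T' l).1.1 v‖ ≤ ‖M (Q l)‖ * A.powNorm (1 / 2) v := hJnorm _ v
      _ ≤ ‖M‖ * |C| * A.powNorm (1 / 2) v := by
          refine mul_le_mul_of_nonneg_right ?_ (Real.sqrt_nonneg _)
          exact M.le_opNorm_of_le (hQnorm l C hC)
      _ = ‖M‖ * C * A.powNorm (1 / 2) v := by rw [mul_assoc, h1, mul_assoc]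
  · refine A.dual_ext fun p => ?_
    refine (hT' l p.1 p.2).unique ?_
    simp only [hl, pivot_basisVec]
    exact hT x p.1 p.2
  · have hcoord : ∀ i n, (B u).1 (A.basisVec (i, n)) = e.repr u i * A.coeff e B i n := by
      intro i n
      have := h.control_basisVec (e.repr u) i n
      rwa [e.sum_repr u] at this
    have hbound : ∀ p, ‖(B u).1 (A.basisVec p)‖ ≤ (∑ i, ‖e.repr u i‖) * R := by
      rintro ⟨i, n⟩
      rw [hcoord, norm_mul]
      exact mul_le_mul (Finset.single_le_sum (f := fun i => ‖e.repr u i‖)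
        (fun _ _ => norm_nonneg _) (Finset.mem_univ i)) (h.norm_coeff_le i n) (norm_nonneg _)
        (Finset.sum_nonneg fun _ _ => norm_nonneg _)
    have hsum : Summable fun p => ‖(B u).1 (A.basisVec p) / A.halfWeight p‖ ^ 2 := by
      refine Summable.of_nonneg_of_le (fun _ => sq_nonneg _) (fun p => ?_)
        ((hyp.summable_inv_weight hyp.inv_two_mul_lt).mul_left (((∑ i, ‖e.repr u i‖) * R) ^ 2))
      rw [norm_div, norm_ofReal_halfWeight, div_pow, halfWeight_sq, div_eq_mul_inv]
      exact mul_le_mul_of_nonneg_right (pow_le_pow_left₀ (norm_nonneg _) (hbound p) 2)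
        (inv_nonneg.2 (A.weight_nonneg _ p))
    obtain ⟨y, hy⟩ := exists_inner_eq A.φ hsum
    have hBu : ((J y : A.DualPow (1 / 2)) : A.Dual) = B u := by
      refine A.dual_ext fun p => ?_
      rw [hJ, hy, mul_div_cancel₀ _ (A.ofReal_halfWeight_ne p)]
    have hmem : B u ∈ A.DualPow (1 / 2) := hBu ▸ (J y).2
    refine ⟨hmem, A.dual_ext fun p => ?_⟩
    refine (hT' ⟨B u, hmem⟩ p.1 p.2).unique ?_
    rw [hcoord]
    refine ((h.hasSum_transEntry_coeff p.1 p.2).mul_left (e.repr u p.1)).congr_fun fun n => ?_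
    rw [hcoord]
    ring

end Estimates

end DiagonalOperator

/-! ### Growth of semigroups, and conjugation with a shift. -/

section Growth

variable {H : Type*} [NormedAddCommGroup H] [NormedSpace ℂ H]

/-- Uniform boundedness on `[0, 1]` gives a constant `M ≥ 1`; iterating over unit steps yields the
exponent `ω = log M`. -/
theorem IsC0Semigroup.exists_norm_le [CompleteSpace H] {S : ℝ≥0 → H →L[ℂ] H}
    (hS : IsC0Semigroup S) : ∃ M ω : ℝ, 0 ≤ M ∧ ∀ t : ℝ≥0, ‖S t‖ ≤ M * Real.exp (ω * t) := by
  obtain ⟨C, hC⟩ : ∃ C, ∀ t : Set.Icc (0 : ℝ≥0) 1, ‖S t‖ ≤ C := by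
    refine banach_steinhaus fun x => ?_
    obtain ⟨C, hC⟩ := isCompact_Icc.exists_bound_of_continuousOn
      (s := Set.Icc (0 : ℝ≥0) 1) (hS.continuous x).continuousOn
    exact ⟨C, fun t => hC t t.2⟩
  let M := max C 1
  have hM1 : 1 ≤ M := le_max_right _ _
  have hM : ∀ t : ℝ≥0, t ≤ 1 → ‖S t‖ ≤ M := fun t ht =>
    (hC ⟨t, zero_le, ht⟩).trans (le_max_left _ _)
  have key : ∀ (n : ℕ) (t : ℝ≥0), t ≤ n + 1 → ‖S t‖ ≤ M ^ (n + 1) := by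
    intro n
    induction n with
    | zero =>
      intro t ht
      simpa using hM t (by simpa using ht)
    | succ n ih =>
      intro t ht
      rcases le_total t 1 with h1 | h1
      · exact (hM t h1).trans (le_self_pow₀ hM1 (Nat.succ_ne_zero _))
      · have e1 : t = 1 + (t - 1) := (add_tsub_cancel_of_le h1).symm
        have h2 : t - 1 ≤ n + 1 := by
          rw [tsub_le_iff_right]
          exact_mod_cast ht
        rw [e1, hS.add]
        calc ‖(S 1).comp (S (t - 1))‖ ≤ ‖S 1‖ * ‖S (t - 1)‖ :=
              ContinuousLinearMap.opNorm_comp_le _ _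
          _ ≤ M * M ^ (n + 1) :=
              mul_le_mul (hM 1 le_rfl) (ih _ h2) (norm_nonneg _) (by linarith)
          _ = M ^ (n + 1 + 1) := (pow_succ' M (n + 1)).symm
  refine ⟨M, Real.log M, by linarith, fun t => ?_⟩
  have hfl : ((⌊t⌋₊ : ℕ) : ℝ) ≤ t := by
    have := Nat.floor_le (zero_le (a := t))
    exact_mod_cast this
  refine (key ⌊t⌋₊ t (Nat.lt_floor_add_one t).le).trans ?_
  rw [pow_succ', ← Real.rpow_natCast, Real.rpow_def_of_pos (by linarith)]
  have := Real.log_nonneg hM1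
  gcongr

theorem tendsto_exp_shift (μ : ℝ) :
    Tendsto (fun t : ℝ≥0 => Complex.exp (-(μ * (t : ℝ)))) (𝓝[>] 0) (𝓝 1) := by
  have : Continuous fun t : ℝ≥0 => Complex.exp (-(μ * (t : ℝ))) := by fun_prop
  have h := this.tendsto 0
  simp only [NNReal.coe_zero, Complex.ofReal_zero, mul_zero, neg_zero, Complex.exp_zero] at h
  exact h.mono_left nhdsWithin_le_nhds

theorem tendsto_exp_shift_sub_one (μ : ℝ) :
    Tendsto (fun t : ℝ≥0 => (((t : ℝ) : ℂ))⁻¹ * (Complex.exp (-(μ * (t : ℝ))) - 1)) (𝓝[>] 0)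
      (𝓝 (-μ)) := by
  have hd : HasDerivAt (fun t : ℝ => Complex.exp (-(μ * (t : ℂ)))) (-μ : ℂ) 0 := by
    have h1 : HasDerivAt (fun t : ℝ => -((μ : ℂ) * (t : ℂ))) (-μ : ℂ) 0 := by
      have h2 := ((hasDerivAt_id (0 : ℝ)).ofReal_comp.const_mul (μ : ℂ)).neg
      simpa using! h2
    simpa using h1.cexp
  have ht : Tendsto (fun t : ℝ≥0 => (t : ℝ)) (𝓝[>] 0) (𝓝[≠] 0) := by
    refine tendsto_nhdsWithin_iff.2 ⟨?_, ?_⟩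
    · exact (NNReal.continuous_coe.tendsto 0).mono_left nhdsWithin_le_nhds
    · filter_upwards [self_mem_nhdsWithin] with t ht
      exact (NNReal.coe_pos.2 ht).ne'
  have h := (hasDerivAt_iff_tendsto_slope_zero.1 hd).comp ht
  refine h.congr fun t => ?_
  simp [Complex.real_smul]

/-- The semigroup `T⁻¹ e^{-μ t} S t T`. -/
noncomputable def conjShift (S : ℝ≥0 → H →L[ℂ] H) (T : H ≃L[ℂ] H) (μ : ℝ) (t : ℝ≥0) :
    H →L[ℂ] H :=
  Complex.exp (-(μ * (t : ℝ))) • ((T.symm : H →L[ℂ] H).comp ((S t).comp (T : H →L[ℂ] H)))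

theorem conjShift_apply (S : ℝ≥0 → H →L[ℂ] H) (T : H ≃L[ℂ] H) (μ : ℝ) (t : ℝ≥0) (x : H) :
    conjShift S T μ t x = Complex.exp (-(μ * (t : ℝ))) • T.symm (S t (T x)) := rfl

theorem IsC0Semigroup.conjShift {S : ℝ≥0 → H →L[ℂ] H} (hS : IsC0Semigroup S) (T : H ≃L[ℂ] H)
    (μ : ℝ) : IsC0Semigroup (conjShift S T μ) where
  zero := by
    ext x
    simp [conjShift_apply, hS.zero]
  add s t := by
    ext x
    simp only [conjShift_apply, hS.add, ContinuousLinearMap.comp_apply, map_smul,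
      ContinuousLinearEquiv.apply_symm_apply, smul_smul, ← Complex.exp_add]
    congr 2
    push_cast
    ring
  continuous x := by
    have h1 : Continuous fun t : ℝ≥0 => Complex.exp (-(μ * (t : ℝ))) := by fun_prop
    exact h1.smul (T.symm.continuous.comp (hS.continuous (T x)))

/-- A product rule for difference quotients: `key` expresses the new quotient through the old one,
and the factor `e^{-μ t}` is invertible with limit `1`, so convergence transfers both ways. -/
theorem isGenerator_conjShift {S : ℝ≥0 → H →L[ℂ] H} {G G' : Submodule ℂ (H × H)}
    (hG : IsGenerator S G) (T : H ≃L[ℂ] H) (μ : ℝ)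
    (hG' : ∀ x y, (x, y) ∈ G' ↔ (T x, T y + (μ : ℂ) • T x) ∈ G) :
    IsGenerator (conjShift S T μ) G' := by
  intro x y
  rw [hG', hG]
  have e1 := tendsto_exp_shift μ
  have e2 := (tendsto_exp_shift_sub_one μ).smul_const (T x)
  have key : ∀ t : ℝ≥0, T ((((t : ℝ) : ℂ))⁻¹ • (conjShift S T μ t x - x)) =
      Complex.exp (-(μ * (t : ℝ))) • ((((t : ℝ) : ℂ))⁻¹ • (S t (T x) - T x)) +
        ((((t : ℝ) : ℂ))⁻¹ * (Complex.exp (-(μ * (t : ℝ))) - 1)) • T x := by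
    intro t
    rw [map_smul, map_sub, conjShift_apply, map_smul, ContinuousLinearEquiv.apply_symm_apply]
    module
  constructor
  · intro h
    have h1 := (e1.smul h).add e2
    simp only [← key] at h1
    have h2 := (T.symm.continuous.tendsto _).comp h1
    simp only [Function.comp_def, ContinuousLinearEquiv.symm_apply_apply] at h2
    convert! h2 using 2
    simp
  · intro h
    have h1 := ((T.continuous.tendsto _).comp h).sub e2
    have h2 := (e1.inv₀ one_ne_zero).smul h1
    simp only [inv_one, one_smul, neg_smul, sub_neg_eq_add] at h2
    refine h2.congr fun t => ?_
    simp only [Function.comp_apply]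
    rw [key, add_sub_cancel_right, smul_smul, inv_mul_cancel₀ (Complex.exp_ne_zero _), one_smul]

theorem norm_conjShift_le {S : ℝ≥0 → H →L[ℂ] H} {M ω : ℝ}
    (hM : ∀ t : ℝ≥0, ‖S t‖ ≤ M * Real.exp (ω * t)) (T : H ≃L[ℂ] H) (μ : ℝ) (t : ℝ≥0) (x : H) :
    ‖conjShift S T μ t x‖ ≤ ‖(T.symm : H →L[ℂ] H)‖ * M * ‖(T : H →L[ℂ] H)‖ *
      Real.exp (-((μ - ω) * t)) * ‖x‖ := by
  have h1 : ‖T.symm (S t (T x))‖ ≤ ‖(T.symm : H →L[ℂ] H)‖ *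
      (M * Real.exp (ω * t) * (‖(T : H →L[ℂ] H)‖ * ‖x‖)) := by
    refine (T.symm : H →L[ℂ] H).le_opNorm_of_le ?_
    exact (S t).le_of_opNorm_le_of_le (hM t) ((T : H →L[ℂ] H).le_opNorm x)
  have h2 : ‖Complex.exp (-(μ * (t : ℝ)))‖ = Real.exp (-(μ * t)) := by
    rw [Complex.norm_exp]
    simp
  rw [conjShift_apply, norm_smul, h2]
  refine (mul_le_mul_of_nonneg_left h1 (Real.exp_pos _).le).trans (le_of_eq ?_)
  have h3 : Real.exp (-((μ - ω) * t)) = Real.exp (-(μ * t)) * Real.exp (ω * t) := by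
    rw [← Real.exp_add]
    ring_nf
  rw [h3]
  ring

end Growth

/-! ### Choice of the shift and conclusion. -/

namespace DiagonalOperator

variable {H : Type*} [NormedAddCommGroup H] [InnerProductSpace ℂ H] [CompleteSpace H] {m : ℕ}

/-- A resonance is the real part of one of countably many differences, and the complement of a
countable set is dense in `ℝ`. -/
theorem exists_nonResonant_gt (A : DiagonalOperator H m) (L : ℝ) :
    ∃ μ : ℝ, L < μ ∧ A.NonResonant μ := by
  let d : Fin m × ℕ × ℕ → ℝ := fun q => (A.ev q.1 q.2.1 - A.ev q.1 q.2.2).re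
  obtain ⟨μ, hμ, hL⟩ := ((Set.countable_range d).dense_compl ℝ).exists_gt L
  refine ⟨μ, hL, fun i k n h => hμ ⟨(i, k, n), ?_⟩⟩
  simp only [d, ← h, Complex.ofReal_re]

end DiagonalOperator

end Backstepping

theorem mainTheorem1 {H : Type*} [NormedAddCommGroup H] [InnerProductSpace ℂ H] [CompleteSpace H]
    {U : Type*} [NormedAddCommGroup U] [NormedSpace ℂ U] {m : ℕ}
    (A : Backstepping.DiagonalOperator H m) (e : Module.Basis (Fin m) ℂ U)
    (B : U →ₗ[ℂ] A.Dual) (α : ℝ) (hyp : A.Framework α e B) :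
    (∀ μ : ℝ, 0 < μ → A.NonResonant μ →
      A.GainConverges μ ∧
      ∃ (T : H ≃L[ℂ] H) (K : H →ₗ.[ℂ] U),
        A.IsTransform e B μ (T : H →L[ℂ] H) ∧ A.IsFeedback α e B μ K ∧
        (∀ f : A.op.domain, ∃ hf : (f : H) ∈ K.domain,
          A.pivot (T (A.op f)) + B (K ⟨f, hf⟩) = A.extend (T f) - (μ : ℂ) • A.pivot (T f)) ∧
        A.FixesControl (T : H →L[ℂ] H) B) ∧
    (∀ rate : ℝ, 0 < rate →
      ∃ (μ : ℝ) (K : H →ₗ.[ℂ] U) (S : NNReal → H →L[ℂ] H),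
        0 < μ ∧ A.NonResonant μ ∧ A.IsFeedback α e B μ K ∧
        Backstepping.IsC0Semigroup S ∧ Backstepping.IsGenerator S (A.closedLoop B K) ∧
        ∃ C : ℝ, 0 < C ∧ ∀ (t : NNReal) (y₀ : H),
          ‖S t y₀‖ ≤ C * Real.exp (-(rate * t)) * ‖y₀‖) := by
  refine ⟨fun μ hμ hr => ?_, fun rate hrate => ?_⟩
  · obtain ⟨R, h⟩ := hyp.exists_estimates hμ hr
    obtain ⟨T, hT, -⟩ := h.exists_transform
    obtain ⟨K, hK, hdom, hKapply⟩ := hyp.exists_feedback h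
    refine ⟨h.gainConverges, T, K,
      Backstepping.DiagonalOperator.Estimates.isTransform_of_hasSum hT, hK, fun f => ?_,
      h.fixesControl hyp hT⟩
    have hf : (f : H) ∈ K.domain := hdom ▸ hyp.domain_le f.2
    refine ⟨hf, ?_⟩
    rw [hKapply]
    exact h.intertwining hyp (T := (T : H →L[ℂ] H)) hT f
  · obtain ⟨S, hS, hgen⟩ := hyp.generates
    obtain ⟨M, ω, hM0, hM⟩ := hS.exists_norm_le
    -- The shift must beat both the prescribed rate and the growth exponent `ω` of the uncontrolled
    -- semigroup.
    obtain ⟨μ, hμL, hr⟩ := A.exists_nonResonant_gt (max 0 (rate + ω))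
    have hμ : 0 < μ := (le_max_left _ _).trans_lt hμL
    have hμω : rate ≤ μ - ω := by
      linarith [(le_max_right 0 (rate + ω)).trans_lt hμL]
    obtain ⟨R, h⟩ := hyp.exists_estimates hμ hr
    obtain ⟨T, hT, hT'⟩ := h.exists_transform
    obtain ⟨K, hK, hdom, hKapply⟩ := hyp.exists_feedback h
    refine ⟨μ, K, Backstepping.conjShift S T μ, hμ, hr, hK, hS.conjShift T μ,
      Backstepping.isGenerator_conjShift hgen T μ (h.mem_closedLoop_iff hyp hT hT' hdom hKapply),
      ‖(T.symm : H →L[ℂ] H)‖ * M * ‖(T : H →L[ℂ] H)‖ + 1, by positivity, fun t y => ?_⟩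
    refine (Backstepping.norm_conjShift_le hM T μ t y).trans ?_
    gcongr
    linarith
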